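/- Let $\Gamma$ be a group and $A$ a $\Gamma$-module. Let ${}_A\mathcal G_\Gamma$ be the category whose objects are $\Gamma$-groups $G$ (groups with an action of $\Gamma$ by automorphisms) together with an action of $G$ on the abelian group $A$ such that ${}^{\sigma}({}^{x}a)={}^{({}^{\sigma}x)}({}^{\sigma}a)$ for $x\in G$, $\sigma\in\Gamma$, $a\in A$, and whose morphisms are the $\Gamma$-equivariant homomorphisms compatible with the actions on $A$. For such $G$, $A$ is a $G\rtimes\Gamma$-module. A $G\rtimes\Gamma$-module is *relatively free* if it is free as a $\mathbb Z(G)$-module with a basis that is a $\Gamma$-subset, and *relatively projective* if it is a retract of a relatively free one. A *relatively projective resolution* of the trivial module $\mathbb Z$ is an exact complex $\cdots\to P_1\to P_0\to\mathbb Z\to 0$ of $G\rtimes\Gamma$-modules with all $P_n$ relatively projective, such that $P_0\to\mathbb Z$, $P_1\to\operatorname{Ker}(P_0\to\mathbb Z)$ and $P_{n+2}\to\operatorname{Ker}(P_{n+1}\to P_n)$, $n\ge 0$, admit sections that are maps of $\Gamma$-sets. Put $H_n^\Gamma(G,A)=H_n(P_*\otimes_{G\rtimes\Gamma}A)$ and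 $H^n_\Gamma(G,A)=H^n(\operatorname{Hom}_{G\rtimes\Gamma}(P_*,A))$. Let $\mathcal F=(F,\tau,\delta)$ be the free cotriple on ${}_A\mathcal G_\Gamma$: $F(G)$ is the free group on the set $G$ with ${}^{\sigma}|g|=|{}^{\sigma}g|$, acting on $A$ through $\tau:F(G)\to G$, $|g|\mapsto g$, and $\delta|g|=||g||$. Let $F_*(G)$ be the simplicial object with $F_n(G)=F^{n+1}(G)$, $\partial_i^n=F^i\tau F^{n-i}$, $s_i^n=F^i\delta F^{n-i}$. For a covariant functor $T$ (respectively a contravariant functor $T$) from ${}_A\mathcal G_\Gamma$ to abelian groups, let $L_n^{\mathcal F}T(G)=\pi_n(T(F_*(G)))$ (respectively $R^n_{\mathcal F}T(G)=\pi^n(T(F_*(G)))$) be the homology (respectively cohomology) of the associated complex with differentials the alternating sums of the (co)face maps. Let $I(G)$ be the kernel of the augmentation $\mathbb Z(G)\to\mathbb Z$, and $\operatorname{Der}_\Gamma(G,A)$ the group of maps $f:G\to A$ with $f(xy)=f(x)+{}^{x}f(y)$ and $f({}^{\sigma}x)={}^{\sigma}f(x)$. Then for every $n\ge 2$ there are isomorphisms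 $$H_n^\Gamma(G,A)\cong L_{n-1}^{\mathcal F}\big(I(-)\otimes_{(-)\rtimes\Gamma}A\big)(G),\qquad H^n_\Gamma(G,A)\cong R^{n-1}_{\mathcal F}\operatorname{Der}_\Gamma(-,A)(G)$$ for all objects $G$ of ${}_A\mathcal G_\Gamma$ and all relatively projective resolutions of $\mathbb Z$ used to compute the left-hand sides, and these isomorphisms are natural in $G$ (with respect to the maps induced on the left-hand sides by chain maps of resolutions over the identity of $\mathbb Z$ along morphisms $G\to H$). -/

import Mathlib

open CategoryTheory

open scoped TensorProduct

namespace CotripleResolution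

universe v u

variable {C : Type u} [Category.{v} C] (W : Comonad C)

/-- The iterates `W ^ n` of the underlying endofunctor of a comonad. -/
def iter : ℕ → (C ⥤ C)
  | 0 => 𝟭 C
  | n + 1 => iter n ⋙ W.toFunctor

variable {W}

/-- `W ^ (b + 1) ⟶ W ^ b ⟶ H`, starting with the counit. -/
def epsCons {b : ℕ} {H : C ⥤ C} (t : iter W b ⟶ H) : iter W (b + 1) ⟶ H where
  app X := W.ε.app ((iter W b).obj X) ≫ t.app X
  naturality X Y f := by
    have := W.ε.naturality ((iter W b).map f)
    simp only [Functor.id_map] at this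
    simp [iter, reassoc_of% this]

/-- `W ^ (b + 1) ⟶ W (W ^ (b + 1)) ⟶ W (W ^ a)`, starting with the comultiplication. -/
def deltaCons {a b : ℕ} (t : iter W (b + 1) ⟶ iter W a) : iter W (b + 1) ⟶ iter W (a + 1) where
  app X := W.δ.app ((iter W b).obj X) ≫ W.map (t.app X)
  naturality X Y f := by
    have := W.δ.naturality ((iter W b).map f)
    have h2 := t.naturality f
    simp only [Functor.comp_map] at this
    simp only [iter, Functor.comp_map, Category.assoc, Functor.comp_obj] at h2 ⊢
    rw [reassoc_of% this, ← W.map_comp, h2, W.map_comp]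

/-- Removing the first point of the source. -/
def tailHom {a b : ℕ} (θ : Fin (a + 1) →o Fin b) : Fin a →o Fin b :=
  θ.comp ⟨Fin.succ, fun _ _ h => Fin.succ_le_succ_iff.2 h⟩

/-- Removing the first point of the target, when it is not in the image. -/
def predHom {a b : ℕ} (θ : Fin a →o Fin (b + 1)) (h : ∀ i, θ i ≠ 0) : Fin a →o Fin b :=
  ⟨fun i => (θ i).pred (h i), fun _ _ hij => Fin.pred_le_pred_iff.2 (θ.monotone hij)⟩

lemma ne_zero_of_ne {a b : ℕ} (θ : Fin (a + 1) →o Fin (b + 1)) (h : θ 0 ≠ 0) (i) : θ i ≠ 0 := by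
  intro hi
  have := θ.monotone (Fin.zero_le i)
  rw [hi] at this
  exact h (Fin.le_zero_iff.1 this)

/-- The natural transformation `W ^ b ⟶ W ^ a` of a monotone map `θ : {0,…,a-1} → {0,…,b-1}`:
the fibre of `θ` over the `i`-th point has some cardinality `k`, and the `i`-th factor `W` is sent
to `W ^ k` by the iterated comultiplication (the counit for `k = 0`). -/
def opMap : ∀ {a b : ℕ}, (Fin a →o Fin b) → (iter W b ⟶ iter W a)
  | 0, 0, _ => 𝟙 _
  | 0, _ + 1, θ => epsCons (opMap (predHom θ fun i => i.elim0))
  | _ + 1, 0, θ => (θ 0).elim0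
  | _ + 1, _ + 1, θ =>
    if h : θ 0 = 0 then deltaCons (opMap (tailHom θ))
    else epsCons (opMap (predHom θ (ne_zero_of_ne θ h)))
  termination_by a b => a + b

lemma opMap_eps {a b : ℕ} (θ : Fin a →o Fin (b + 1)) (h : ∀ i, θ i ≠ 0) :
    (opMap θ : iter W _ ⟶ _) = epsCons (opMap (predHom θ h)) := by
  cases a with
  | zero => rw [opMap]
  | succ a => rw [opMap, dif_neg (h 0)]

lemma opMap_delta {a b : ℕ} (θ : Fin (a + 1) →o Fin (b + 1)) (h : θ 0 = 0) :
    (opMap θ : iter W _ ⟶ _) = deltaCons (opMap (tailHom θ)) := by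
  rw [opMap, dif_pos h]

lemma epsCons_comp {b : ℕ} {H K : C ⥤ C} (t : iter W b ⟶ H) (s : H ⟶ K) :
    epsCons t ≫ s = epsCons (t ≫ s) := by
  ext X
  exact Category.assoc _ _ _

lemma delta_eps_aux {X Y Z : C} (t : W.obj X ⟶ Y) (s : Y ⟶ Z) :
    (W.δ.app X ≫ W.map t) ≫ W.ε.app Y ≫ s = t ≫ s := by
  have := W.ε.naturality t
  simp only [Functor.id_map] at this
  simp [reassoc_of% this]

lemma delta_delta_aux {X Y Z : C} (r : W.obj X ⟶ Y) (s : W.obj Y ⟶ Z) :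
    (W.δ.app X ≫ W.map r) ≫ W.δ.app Y ≫ W.map s =
      W.δ.app X ≫ W.map ((W.δ.app X ≫ W.map r) ≫ s) := by
  have := W.δ.naturality r
  simp only [Functor.comp_map] at this
  simp [reassoc_of% this, W.coassoc_assoc]

lemma deltaCons_epsCons {a b : ℕ} {H : C ⥤ C} (t : iter W (b + 1) ⟶ iter W a) (s : iter W a ⟶ H) :
    deltaCons t ≫ epsCons s = t ≫ s := by
  ext X
  exact delta_eps_aux (t.app X) (s.app X)

lemma deltaCons_epsCons_eq {a b : ℕ} (t : iter W b ⟶ iter W a) :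
    deltaCons (epsCons t) = Functor.whiskerRight t W.toFunctor := by
  ext X
  exact (congrArg (fun f => W.δ.app _ ≫ f) (W.map_comp _ _)).trans (W.right_counit_assoc ((iter W b).obj X) (W.map (t.app X)))

lemma deltaCons_deltaCons {a b c : ℕ} (t : iter W (b + 1) ⟶ iter W (a + 1))
    (s : iter W (a + 1) ⟶ iter W c) (r : iter W (b + 1) ⟶ iter W a) (h : t = deltaCons r) :
    deltaCons r ≫ deltaCons s = deltaCons (t ≫ s) := by
  subst h
  ext X
  exact delta_delta_aux (r.app X) (s.app X)

lemma opMap_id (a : ℕ) : (opMap (OrderHom.id : Fin a →o Fin a) : iter W a ⟶ _) = 𝟙 _ := by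
  induction a with
  | zero => rw [opMap]
  | succ a ih =>
    rw [opMap_delta _ rfl, opMap_eps _ (fun i => Fin.succ_ne_zero i)]
    have : predHom (tailHom (OrderHom.id : Fin (a + 1) →o Fin (a + 1)))
        (fun i => Fin.succ_ne_zero i) = OrderHom.id := by
      apply OrderHom.ext; funext i; rfl
    rw [this, ih]
    ext X
    refine (congrArg (fun f => W.δ.app _ ≫ W.map f) (Category.comp_id _)).trans ?_
    exact W.right_counit _

lemma opMap_comp : ∀ {a b c : ℕ} (θ : Fin a →o Fin b) (φ : Fin b →o Fin c),
    (opMap (φ.comp θ) : iter W c ⟶ _) = opMap φ ≫ opMap θ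
  | 0, 0, 0, θ, φ => by
    rw [Subsingleton.elim (φ.comp θ) OrderHom.id, Subsingleton.elim φ OrderHom.id,
      Subsingleton.elim θ OrderHom.id, opMap_id]; simp
  | _ + 1, 0, _, θ, φ => (θ 0).elim0
  | _, _ + 1, 0, θ, φ => (φ 0).elim0
  | a, b, c + 1, θ, φ => by
    by_cases h : ∀ i, φ i ≠ 0
    · rw [opMap_eps φ h, opMap_eps (φ.comp θ) (fun i => h _), epsCons_comp, ← opMap_comp]
      rfl
    · match b, φ, θ, h with
      | 0, φ, θ, h => exact absurd (fun i : Fin 0 => i.elim0) h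
      | b + 1, φ, θ, h =>
        have h0 : φ 0 = 0 := by
          by_contra h0
          exact h (ne_zero_of_ne φ h0)
        by_cases h' : ∀ i, θ i ≠ 0
        · rw [opMap_delta φ h0, opMap_eps θ h', deltaCons_epsCons, ← opMap_comp]
          congr 1
          apply OrderHom.ext
          funext i
          exact congrArg φ (Fin.succ_pred _ (h' i)).symm
        · match a, θ, h' with
          | 0, θ, h' => exact absurd (fun i : Fin 0 => i.elim0) h'
          | a + 1, θ, h' =>
            have h0' : θ 0 = 0 := by
              by_contra h0'
              exact h' (ne_zero_of_ne θ h0')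
            rw [opMap_delta φ h0, opMap_delta θ h0',
              deltaCons_deltaCons _ _ _ (opMap_delta φ h0), ← opMap_comp,
              opMap_delta _ (by simp [h0, h0'])]
            rfl
  termination_by a b c => a + b + c

variable (W)

/-- The (free) cotriple resolution `W_* X` of an object `X`: the simplicial object with
`W_n X = W ^ (n + 1) X`, faces `W^i ε W^(n-i)` and degeneracies `W^i δ W^(n-i)` (see `resolution_δ`
and `resolution_σ`). -/
def resolution : C ⥤ SimplicialObject C where
  obj X :=
    { obj := fun n => (iter W (n.unop.len + 1)).obj X
      map := fun θ => (opMap θ.unop.toOrderHom).app X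
      map_id := fun n => by
        have := congr_app (opMap_id (W := W) (n.unop.len + 1)) X
        exact this
      map_comp := fun θ φ => by
        have := congr_app (opMap_comp (W := W) φ.unop.toOrderHom θ.unop.toOrderHom) X
        exact this }
  map f :=
    { app := fun n => (iter W (n.unop.len + 1)).map f
      naturality := fun _ _ θ => ((opMap θ.unop.toOrderHom).naturality f).symm }
  map_id _ := by ext; simp
  map_comp _ _ := by ext; simp

/-- The natural transformation `∂_i = W^i ε W^(n-i) : W ^ (n + 1) ⟶ W ^ n`. -/
def face : ∀ (n : ℕ) (_ : Fin (n + 1)), iter W (n + 1) ⟶ iter W n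
  | n, ⟨0, _⟩ => Functor.whiskerLeft (iter W n) W.ε
  | n + 1, ⟨i + 1, h⟩ => Functor.whiskerRight (face n ⟨i, Nat.lt_of_succ_lt_succ h⟩) W.toFunctor

/-- The natural transformation `s_i = W^i δ W^(n-i) : W ^ (n + 1) ⟶ W ^ (n + 2)`. -/
def degeneracy : ∀ (n : ℕ) (_ : Fin (n + 1)), iter W (n + 1) ⟶ iter W (n + 2)
  | n, ⟨0, _⟩ => Functor.whiskerLeft (iter W n) W.δ
  | n + 1, ⟨i + 1, h⟩ =>
    Functor.whiskerRight (degeneracy n ⟨i, Nat.lt_of_succ_lt_succ h⟩) W.toFunctor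

lemma tailHom_succ_ne {n m : ℕ} (θ : Fin (n + 1) →o Fin (m + 1))
    (h : ∀ j : Fin n, θ j.succ ≠ 0) (j) : tailHom θ j ≠ 0 := h j

lemma opMap_succAbove (n : ℕ) (i : Fin (n + 1)) :
    opMap (Fin.succAboveOrderEmb i).toOrderHom = face W n i := by
  have zero (n : ℕ) : opMap (Fin.succAboveOrderEmb (0 : Fin (n + 1))).toOrderHom = face W n 0 := by
    have h (j) : (Fin.succAboveOrderEmb (0 : Fin (n + 1))).toOrderHom j ≠ 0 := by simp
    have : predHom _ h = OrderHom.id := by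
      apply OrderHom.ext; funext j
      simp [predHom]
    rw [opMap_eps _ h, this, opMap_id]
    ext X
    refine (Category.comp_id (W.ε.app ((iter W n).obj X))).trans ?_
    cases n <;> rfl
  induction n with
  | zero =>
    obtain rfl : i = 0 := Fin.ext (by omega)
    exact zero 0
  | succ n ih =>
    refine Fin.cases (zero _) (fun i => ?_) i
    have h0 : ∀ j, tailHom (Fin.succAboveOrderEmb i.succ).toOrderHom j ≠ 0 :=
      tailHom_succ_ne _ fun j => by simp
    have : predHom _ h0 = (Fin.succAboveOrderEmb i).toOrderHom := by
      apply OrderHom.ext; funext j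
      exact (Fin.pred_eq_iff_eq_succ (h0 j)).2 (Fin.succ_succAbove_succ i j)
    rw [opMap_delta _ (by simp), opMap_eps _ h0, deltaCons_epsCons_eq, this, ih]
    rfl

lemma opMap_predAbove (n : ℕ) (i : Fin (n + 1)) :
    opMap ⟨Fin.predAbove i, Fin.predAbove_right_monotone i⟩ = degeneracy W n i := by
  have zero (n : ℕ) : opMap ⟨Fin.predAbove 0, Fin.predAbove_right_monotone 0⟩ =
      degeneracy W n 0 := by
    have : tailHom ⟨Fin.predAbove (0 : Fin (n + 1)), Fin.predAbove_right_monotone _⟩ =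
        OrderHom.id := by
      apply OrderHom.ext; funext j
      exact Fin.predAbove_zero_succ
    rw [opMap_delta _ (by simp), this, opMap_id]
    ext X
    refine ((congrArg (fun f => W.δ.app ((iter W n).obj X) ≫ f) (W.map_id _)).trans
      (Category.comp_id _)).trans ?_
    cases n <;> rfl
  induction n with
  | zero =>
    obtain rfl : i = 0 := Fin.ext (by omega)
    exact zero 0
  | succ n ih =>
    refine Fin.cases (zero _) (fun i => ?_) i
    have h0 : ∀ j, tailHom ⟨Fin.predAbove i.succ, Fin.predAbove_right_monotone _⟩ j ≠ 0 :=
      tailHom_succ_ne _ fun j => by simp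
    have : predHom _ h0 = ⟨Fin.predAbove i, Fin.predAbove_right_monotone i⟩ := by
      apply OrderHom.ext; funext j
      exact (Fin.pred_eq_iff_eq_succ (h0 j)).2 (Fin.succ_predAbove_succ i j)
    rw [opMap_delta _ (by simp), opMap_eps _ h0, deltaCons_epsCons_eq, this, ih]
    rfl

lemma resolution_δ (X : C) (n : ℕ) (i : Fin (n + 2)) :
    ((resolution W).obj X).δ i = (face W (n + 1) i).app X :=
  congr_app (opMap_succAbove W (n + 1) i) X

lemma resolution_σ (X : C) (n : ℕ) (i : Fin (n + 1)) :
    ((resolution W).obj X).σ i = (degeneracy W n i).app X :=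
  congr_app (opMap_predAbove W n i) X

section Derived

variable {D : Type*} [Category* D] [Abelian D]

/-- The left cotriple derived functors `L_n T (X) = π_n (T (W_* X))` of a functor `T` with values in
an abelian category: the homology of the chain complex of the simplicial object `T (W_* X)`, whose
differential is `∑ (-1)^i ∂_i`. -/
noncomputable def leftDerived (T : C ⥤ D) (n : ℕ) : C ⥤ D :=
  resolution W ⋙ (SimplicialObject.whiskering C D).obj T ⋙
    AlgebraicTopology.alternatingFaceMapComplex D ⋙ HomologicalComplex.homologyFunctor D _ n

/-- The right cotriple derived functors `R^n T (X)` of a contravariant functor `T`: the cohomology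
of the cochain complex of the cosimplicial object `T (W_* X)`, with differential `∑ (-1)^i ∂^i`. -/
noncomputable def rightDerived (T : Cᵒᵖ ⥤ D) (n : ℕ) : Cᵒᵖ ⥤ D :=
  (resolution W).op ⋙ (simplicialCosimplicialEquiv C).functor ⋙
    (CosimplicialObject.whiskering Cᵒᵖ D).obj T ⋙
    AlgebraicTopology.alternatingCofaceMapComplex D ⋙ HomologicalComplex.homologyFunctor D _ n

end Derived

end CotripleResolution


namespace EquivariantHomology

noncomputable section

universe u v w

/-! ### Tensor products over group rings -/

section Tensor

variable {k : Type v} [CommRing k] {S T U : Type w} [Group S] [Group T] [Group U]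

/-- `M ⊗_S B` for (left) `S`-modules `M` and `B`, where `M` is made a right module through
`x s = s⁻¹ x`: the coinvariants of `M ⊗ B` under the diagonal action. -/
def tensorOver (M B : Rep.{u} k S) : ModuleCat.{u} k :=
  ModuleCat.of k (M.ρ.tprod B.ρ).Coinvariants

/-- The class of `x ⊗ b` in `M ⊗_S B`. -/
def tmk {M B : Rep.{u} k S} (x : M.V) (b : B.V) : tensorOver M B :=
  Representation.Coinvariants.mk (M.ρ.tprod B.ρ) (x ⊗ₜ[k] b)

lemma tensorOver_ext {M B : Rep.{u} k S} {N : ModuleCat.{u} k} {p q : tensorOver M B ⟶ N}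
    (h : ∀ x b, p.hom (tmk x b) = q.hom (tmk x b)) : p = q := by
  apply ModuleCat.hom_ext
  apply Representation.Coinvariants.hom_ext
  apply TensorProduct.ext'
  exact h

/-- The map `M ⊗_S B → N ⊗_T B'`, `x ⊗ b ↦ g x ⊗ h b`, induced by maps `g : M → N` and `h : B → B'`
which are equivariant along a homomorphism `φ : S → T`. -/
def tensorOverMap (φ : S →* T) {M B : Rep.{u} k S} {N B' : Rep.{u} k T} (g : M ⟶ Rep.res φ N)
    (h : B ⟶ Rep.res φ B') : tensorOver M B ⟶ tensorOver N B' :=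
  ModuleCat.ofHom (Representation.Coinvariants.lift _
    (Representation.Coinvariants.mk (N.ρ.tprod B'.ρ) ∘ₗ
      TensorProduct.map g.hom.toLinearMap h.hom.toLinearMap) fun s => by
      apply TensorProduct.ext'
      intro x b
      refine Eq.trans ?_ (Representation.Coinvariants.mk_self_apply (N.ρ.tprod B'.ρ) (φ s)
        (g.hom x ⊗ₜ[k] h.hom b))
      exact congrArg (Representation.Coinvariants.mk (N.ρ.tprod B'.ρ))
        (congrArg₂ (fun y b => y ⊗ₜ[k] b) (Rep.hom_comm_apply g s x) (Rep.hom_comm_apply h s b)))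

lemma tensorOverMap_tmk (φ : S →* T) {M B : Rep.{u} k S} {N B' : Rep.{u} k T} (g : M ⟶ Rep.res φ N)
    (h : B ⟶ Rep.res φ B') (x : M.V) (b : B.V) :
    (tensorOverMap φ g h).hom (tmk x b) = tmk (M := N) (B := B') (g.hom x) (h.hom b) := rfl

/-- The functor `- ⊗_S B`. -/
def tensorFunctor (B : Rep.{u} k S) : Rep.{u} k S ⥤ ModuleCat.{u} k where
  obj M := tensorOver M B
  map g := tensorOverMap (MonoidHom.id S) g (𝟙 B)
  map_id _ := tensorOver_ext fun _ _ => rfl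
  map_comp _ _ := tensorOver_ext fun _ _ => rfl

instance (B : Rep.{u} k S) : (tensorFunctor B).Additive where
  map_add {_ N g h} := tensorOver_ext fun x b =>
    (congrArg (Representation.Coinvariants.mk (N.ρ.tprod B.ρ))
      (TensorProduct.add_tmul (g.hom x) (h.hom x) b)).trans (map_add _ _ _)

end Tensor

variable {Γ : Type u} [Group Γ] {A : Type u} [AddCommGroup A]

/-- The objects of the category `_A𝒢_Γ`, for a fixed `Γ`-module `(A, α)`: groups `G` with an action
of `Γ` by automorphisms, together with an action of `G` on the abelian group `A` such that
`σ (x a) = (σ x) (σ a)`. -/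
structure GammaGroup (α : Representation ℤ Γ A) where
  /-- the underlying group -/
  carrier : Type u
  [group : Group carrier]
  /-- the action of `Γ` on the group -/
  act : Γ →* MulAut carrier
  /-- the action of the group on `A` -/
  ρ : Representation ℤ carrier A
  compat : ∀ (σ : Γ) (x : carrier) (a : A), α σ (ρ x a) = ρ (act σ x) (α σ a)

attribute [instance] GammaGroup.group

namespace GammaGroup

variable {α : Representation ℤ Γ A}

/-- Morphisms: `Γ`-equivariant group homomorphisms compatible with the actions on `A`. -/
@[ext]
structure Hom (G H : GammaGroup α) where
  /-- the underlying group homomorphism -/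
  hom : G.carrier →* H.carrier
  map_act : ∀ (σ : Γ) (x : G.carrier), hom (G.act σ x) = H.act σ (hom x)
  map_ρ : ∀ x : G.carrier, H.ρ (hom x) = G.ρ x

instance : Category (GammaGroup α) where
  Hom := Hom
  id G := ⟨MonoidHom.id _, fun _ _ => rfl, fun _ => rfl⟩
  comp f g := ⟨g.hom.comp f.hom, fun σ x => by simp [f.map_act, g.map_act],
    fun x => by simp [f.map_ρ, g.map_ρ]⟩

@[ext]
lemma hom_ext {G H : GammaGroup α} {f g : G ⟶ H} (h : f.hom = g.hom) : f = g := Hom.ext h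

@[simp] lemma id_hom (G : GammaGroup α) : Hom.hom (𝟙 G) = MonoidHom.id _ := rfl

@[simp] lemma comp_hom {G H K : GammaGroup α} (f : G ⟶ H) (g : H ⟶ K) :
    (f ≫ g).hom = g.hom.comp f.hom := rfl

/-! ### The free cotriple -/

/-- The canonical homomorphism `τ : F(G) → G`, `|g| ↦ g`, from the free group on the set `G`. -/
def freeCounit (G : Type u) [Group G] : FreeGroup G →* G := FreeGroup.lift id

lemma freeCounit_map {G H : Type u} [Group G] [Group H] (f : G →* H) (w : FreeGroup G) :
    freeCounit H (FreeGroup.map f w) = f (freeCounit G w) := by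
  have : (freeCounit H).comp (FreeGroup.map f) = f.comp (freeCounit G) := by
    ext x; simp [freeCounit]
  exact DFunLike.congr_fun this w

/-- The free `Γ`-group `F(G)` on the underlying `Γ`-set of `G`, with `σ |g| = |σ g|`; it acts on `A`
through `τ : F(G) → G`. -/
def freeObj (G : GammaGroup α) : GammaGroup α where
  carrier := FreeGroup G.carrier
  act :=
    { toFun := fun σ => FreeGroup.freeGroupCongr (G.act σ).toEquiv
      map_one' := by
        ext x
        simp [FreeGroup.map.id]
      map_mul' := fun σ τ => by
        ext x
        simp [FreeGroup.map.comp] }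
  ρ := G.ρ.comp (freeCounit G.carrier)
  compat σ w a := by
    have := G.compat σ (freeCounit G.carrier w) a
    rw [← MulEquiv.coe_toMonoidHom, ← freeCounit_map] at this
    exact this

/-- `F(f) |g| = |f g|`. -/
def freeMap {G H : GammaGroup α} (f : G ⟶ H) : G.freeObj ⟶ H.freeObj where
  hom := FreeGroup.map f.hom
  map_act σ w := by
    have : (FreeGroup.map f.hom).comp (FreeGroup.map (G.act σ)) =
        (FreeGroup.map (H.act σ)).comp (FreeGroup.map f.hom) := by
      ext x; simp [f.map_act]
    exact DFunLike.congr_fun this w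
  map_ρ w := by
    exact (congrArg H.ρ (freeCounit_map f.hom w)).trans (f.map_ρ (freeCounit G.carrier w))

/-- The free cotriple `(F, τ, δ)`: `τ |g| = g` and `δ |g| = ||g||`. -/
def freeCotriple (α : Representation ℤ Γ A) : Comonad (GammaGroup α) where
  obj := freeObj
  map := freeMap
  map_id G := by
    apply hom_ext
    apply FreeGroup.ext_hom
    intro x
    rfl
  map_comp f g := by
    apply hom_ext
    apply FreeGroup.ext_hom
    intro x
    rfl
  ε :=
    { app := fun G =>
        { hom := freeCounit G.carrier
          map_act := fun σ w => freeCounit_map (G.act σ).toMonoidHom w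
          map_ρ := fun w => rfl }
      naturality := fun G H f => by
        apply hom_ext
        apply FreeGroup.ext_hom
        intro x
        exact (FreeGroup.lift_apply_of).trans (congrArg f.hom (FreeGroup.lift_apply_of).symm) }
  δ :=
    { app := fun G =>
        { hom := FreeGroup.map FreeGroup.of
          map_act := fun σ w => by
            have : (FreeGroup.map (FreeGroup.of (α := G.carrier))).comp (FreeGroup.map (G.act σ)) =
                (FreeGroup.map (G.freeObj.act σ)).comp (FreeGroup.map FreeGroup.of) := by
              apply FreeGroup.ext_hom
              intro x
              rfl
            exact DFunLike.congr_fun this w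
          map_ρ := fun w => by
            have : (freeCounit (FreeGroup G.carrier)).comp (FreeGroup.map FreeGroup.of) =
                MonoidHom.id _ := by
              ext x; simp [freeCounit]
            have h := DFunLike.congr_fun this w
            exact congrArg (fun w => G.ρ (freeCounit G.carrier w)) h }
      naturality := fun G H f => by
        apply hom_ext
        apply FreeGroup.ext_hom
        intro x
        rfl }
  coassoc G := by
    apply hom_ext
    apply FreeGroup.ext_hom
    intro x
    rfl
  left_counit G := by
    apply hom_ext
    apply FreeGroup.ext_hom
    intro x
    rfl
  right_counit G := by
    apply hom_ext
    apply FreeGroup.ext_hom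
    intro x
    exact congrArg FreeGroup.of (FreeGroup.lift_apply_of (f := id))

end GammaGroup

namespace GammaGroup

variable {α : Representation ℤ Γ A}

/-! ### `G ⋊ Γ`-modules -/

/-- The semidirect product `G ⋊ Γ`. -/
abbrev sd (G : GammaGroup α) : Type u := G.carrier ⋊[G.act] Γ

/-- The homomorphism `G ⋊ Γ → H ⋊ Γ` induced by a morphism `G ⟶ H`. -/
def sdMap {G H : GammaGroup α} (f : G ⟶ H) : G.sd →* H.sd :=
  SemidirectProduct.map f.hom (MonoidHom.id Γ) fun σ => by
    ext x; exact f.map_act σ x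

/-- The action of `G ⋊ Γ` on `A`: `(g, σ) a = g (σ a)`. -/
def coeffRep (G : GammaGroup α) : Representation ℤ G.sd A where
  toFun s := G.ρ s.left * α s.right
  map_one' := by simp
  map_mul' s t := by
    ext a
    simp [G.compat]

/-- `A` as a `G ⋊ Γ`-module. -/
abbrev coeff (G : GammaGroup α) : Rep.{u} ℤ G.sd := Rep.of G.coeffRep

lemma coeffRep_sdMap {G H : GammaGroup α} (f : G ⟶ H) (s : G.sd) :
    H.coeffRep (sdMap f s) = G.coeffRep s := by
  simp [coeffRep, sdMap, f.map_ρ]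

/-- The identity of `A`, as a map from the `G ⋊ Γ`-module `A` to the restriction of the
`H ⋊ Γ`-module `A`. -/
def coeffToRes {G H : GammaGroup α} (f : G ⟶ H) : G.coeff ⟶ Rep.res (sdMap f) H.coeff :=
  Rep.ofHom ⟨LinearMap.id, fun s => by
    ext a; exact (LinearMap.congr_fun (coeffRep_sdMap f s) a).symm⟩

/-- The identity of `A`, as a map from the restriction of the `H ⋊ Γ`-module `A` to the
`G ⋊ Γ`-module `A`. -/
def resToCoeff {G H : GammaGroup α} (f : G ⟶ H) : Rep.res (sdMap f) H.coeff ⟶ G.coeff :=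
  Rep.ofHom ⟨LinearMap.id, fun s => by
    ext a; exact LinearMap.congr_fun (coeffRep_sdMap f s) a⟩

/-- The action of `G ⋊ Γ` on the set `G`: `(g, σ) x = g (σ x)`. -/
def leftAct (G : GammaGroup α) (s : G.sd) (x : G.carrier) : G.carrier := s.left * G.act s.right x

/-- The group ring `ℤ(G)` (as an additive group, the free abelian group on `G`) with its
`G ⋊ Γ`-module structure `(g, σ) ∑ mᵢ gᵢ = ∑ mᵢ g (σ gᵢ)`. -/
def groupRing (G : GammaGroup α) : Representation ℤ G.sd (G.carrier →₀ ℤ) where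
  toFun s := Finsupp.lmapDomain ℤ ℤ (G.leftAct s)
  map_one' := by
    ext x y
    simp [leftAct]
  map_mul' s t := by
    ext x y
    simp [leftAct, mul_assoc]

/-- The augmentation `ε : ℤ(G) → ℤ`. -/
def augmentation (G : GammaGroup α) : (G.carrier →₀ ℤ) →ₗ[ℤ] ℤ :=
  Finsupp.linearCombination ℤ fun _ => (1 : ℤ)

lemma augmentation_lmapDomain {G H : GammaGroup α} (f : G.carrier → H.carrier)
    (x : G.carrier →₀ ℤ) :
    H.augmentation (Finsupp.lmapDomain ℤ ℤ f x) = G.augmentation x := by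
  have : H.augmentation ∘ₗ Finsupp.lmapDomain ℤ ℤ f = G.augmentation := by
    ext x; simp [augmentation]
  exact LinearMap.congr_fun this x

/-- `I(G) = Ker ε` as an abelian group. -/
def augIdeal (G : GammaGroup α) : Submodule ℤ (G.carrier →₀ ℤ) := LinearMap.ker G.augmentation

/-- `I(G) = Ker ε` as a `G ⋊ Γ`-module. -/
def augIdealRep (G : GammaGroup α) : Rep.{u} ℤ G.sd :=
  Rep.of (G.groupRing.subrepresentation G.augIdeal fun s x hx =>
    (augmentation_lmapDomain (G.leftAct s) x).trans hx)

/-- The map `I(G) → I(H)` induced by a morphism `f : G ⟶ H`. -/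
def augIdealMap {G H : GammaGroup α} (f : G ⟶ H) :
    G.augIdealRep ⟶ Rep.res (sdMap f) H.augIdealRep :=
  Rep.ofHom ⟨((Finsupp.lmapDomain ℤ ℤ f.hom).restrict fun x hx =>
      (augmentation_lmapDomain f.hom x).trans hx : G.augIdeal →ₗ[ℤ] H.augIdeal), fun s => by
    apply LinearMap.ext
    intro x
    apply Subtype.ext
    have : Finsupp.lmapDomain ℤ ℤ f.hom ∘ₗ G.groupRing s =
        H.groupRing (sdMap f s) ∘ₗ Finsupp.lmapDomain ℤ ℤ f.hom := by
      ext x y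
      simp [groupRing, leftAct, sdMap, f.map_act]
    exact LinearMap.congr_fun this x.1⟩

/-! ### The functors `I(-) ⊗ A` and `Der_Γ(-, A)` on `_A𝒢_Γ` -/

/-- The functor `G ↦ I(G) ⊗_{G ⋊ Γ} A`. -/
def augTensor (α : Representation ℤ Γ A) : GammaGroup α ⥤ ModuleCat.{u} ℤ where
  obj G := tensorOver G.augIdealRep G.coeff
  map f := tensorOverMap (sdMap f) (augIdealMap f) (coeffToRes f)
  map_id G := tensorOver_ext fun _ a =>
    congrArg (fun z : G.augIdeal => tmk (M := G.augIdealRep) (B := G.coeff) z a)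
      (Subtype.ext Finsupp.mapDomain_id)
  map_comp {_ _ K} f g := tensorOver_ext fun x a =>
    congrArg (fun z : K.augIdeal => tmk (M := K.augIdealRep) (B := K.coeff) z a)
      (Subtype.ext (Finsupp.mapDomain_comp (f := f.hom) (g := g.hom) (v := x.1)))

/-- The group `Der_Γ(G, A)` of `Γ`-derivations. -/
def der (G : GammaGroup α) : Submodule ℤ (G.carrier → A) where
  carrier := {d | (∀ x y, d (x * y) = d x + G.ρ x (d y)) ∧ ∀ σ x, d (G.act σ x) = α σ (d x)}
  zero_mem' := by simp
  add_mem' {d e} hd he := by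
    refine ⟨fun x y => ?_, fun σ x => ?_⟩
    · simp only [Pi.add_apply, hd.1, he.1, map_add]; abel
    · simp only [Pi.add_apply, hd.2, he.2, map_add]
  smul_mem' m d hd := by
    refine ⟨fun x y => ?_, fun σ x => ?_⟩
    · simp only [Pi.smul_apply, hd.1, smul_add, map_zsmul]
    · simp only [Pi.smul_apply, hd.2, map_zsmul]

/-- The contravariant functor `G ↦ Der_Γ(G, A)`. -/
def derFunctor (α : Representation ℤ Γ A) : (GammaGroup α)ᵒᵖ ⥤ ModuleCat.{u} ℤ where
  obj G := ModuleCat.of ℤ G.unop.der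
  map {H G} f := ModuleCat.ofHom
    ((LinearMap.funLeft ℤ A f.unop.hom).restrict fun d hd => by
      refine ⟨fun x y => ?_, fun σ x => ?_⟩
      · simp only [LinearMap.funLeft_apply, map_mul]
        rw [hd.1, f.unop.map_ρ]
      · simp only [LinearMap.funLeft_apply]
        rw [f.unop.map_act, hd.2] : H.unop.der →ₗ[ℤ] G.unop.der)
  map_id _ := rfl
  map_comp _ _ := rfl

/-! ### Relatively projective resolutions -/

/-- Relatively free `G ⋊ Γ`-modules: free as a `G`-module with basis a `Γ`-subset `s`. (A set `s` is
a basis over `ℤ(G)` if and only if the elements `g x`, `g ∈ G`, `x ∈ s`, form a `ℤ`-basis.) -/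
def IsRelFree {G : GammaGroup α} (M : Rep.{u} ℤ G.sd) : Prop :=
  ∃ s : Set M.V, (∀ (σ : Γ), ∀ x ∈ s, M.ρ (SemidirectProduct.inr σ) x ∈ s) ∧
    LinearIndependent ℤ (fun p : G.carrier × s => M.ρ (SemidirectProduct.inl p.1) p.2.1) ∧
    Submodule.span ℤ (Set.range
      fun p : G.carrier × s => M.ρ (SemidirectProduct.inl p.1) p.2.1) = ⊤

/-- Relatively projective `G ⋊ Γ`-modules: retracts of relatively free ones. -/
def IsRelProjective {G : GammaGroup α} (M : Rep.{u} ℤ G.sd) : Prop :=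
  ∃ F : Rep.{u} ℤ G.sd, IsRelFree F ∧ Nonempty (Retract M F)

/-- Over the `Γ`-stable subset `K` of `N`, the map `f : M → N` has a section that is a `Γ`-map. -/
def IsGammaSplitOver {G : GammaGroup α} {M N : Rep.{u} ℤ G.sd} (f : M ⟶ N) (K : Set N.V) : Prop :=
  ∃ γ : N.V → M.V, ∀ x ∈ K, f.hom (γ x) = x ∧
    ∀ σ : Γ, γ (N.ρ (SemidirectProduct.inr σ) x) = M.ρ (SemidirectProduct.inr σ) (γ x)

/-- The trivial `G ⋊ Γ`-module `ℤ`. -/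
abbrev trivialInt (G : GammaGroup α) : Rep.{u} ℤ G.sd := Rep.trivial ℤ G.sd (ULift.{u} ℤ)

/-- A relatively projective resolution `⋯ → P₁ → P₀ → ℤ → 0` of the trivial `G ⋊ Γ`-module `ℤ`: a
complex of relatively projective modules, such that `P₀ → ℤ` and each `P_{n+1} → Ker (P_n → P_{n-1})`
(where `P_{-1} = ℤ`) is a `Γ`-splitting epimorphism. -/
structure RelResolution (G : GammaGroup α) where
  /-- the complex `P_*` -/
  complex : ChainComplex (Rep.{u} ℤ G.sd) ℕ
  /-- the augmentation `P₀ → ℤ` -/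
  ε : complex.X 0 ⟶ G.trivialInt
  d_ε : complex.d 1 0 ≫ ε = 0
  projective : ∀ n, IsRelProjective (complex.X n)
  split_ε : IsGammaSplitOver ε Set.univ
  split_zero : IsGammaSplitOver (complex.d 1 0) {x | ε.hom x = 0}
  split_succ : ∀ n, IsGammaSplitOver (complex.d (n + 2) (n + 1))
    {x | (complex.d (n + 1) n).hom x = 0}

/-- Maps of resolutions along a morphism `f : G ⟶ H`: chain maps that are equivariant along
`G ⋊ Γ → H ⋊ Γ` and lie over the identity of `ℤ`. -/
structure RelResolution.Hom {G H : GammaGroup α} (f : G ⟶ H) (P : RelResolution G)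
    (Q : RelResolution H) where
  /-- the components -/
  φ : ∀ n, P.complex.X n ⟶ Rep.res (sdMap f) (Q.complex.X n)
  comm : ∀ i j, φ i ≫ Rep.resMap (sdMap f) (Q.complex.d i j) = P.complex.d i j ≫ φ j
  comm_ε : ∀ x, Q.ε.hom ((φ 0).hom x) = P.ε.hom x

namespace RelResolution

variable {G H : GammaGroup α}

/-- `H_n^Γ(G, A) = Tor_n(ℤ, A)`, computed by the relatively projective resolution `P` of `ℤ`: the
homology of `P_* ⊗_{G ⋊ Γ} A`. -/
def homology (P : RelResolution G) (n : ℕ) : ModuleCat.{u} ℤ :=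
  (((tensorFunctor G.coeff).mapHomologicalComplex _).obj P.complex).homology n

/-- The map `H_n^Γ(G, A) → H_n^Γ(H, A)` given by a morphism `f : G ⟶ H`, computed by a map of
resolutions along `f`. -/
def homologyMap {f : G ⟶ H} {P : RelResolution G} {Q : RelResolution H} (φ : Hom f P Q) (n : ℕ) :
    P.homology n ⟶ Q.homology n :=
  HomologicalComplex.homologyMap
    (K := ((tensorFunctor G.coeff).mapHomologicalComplex _).obj P.complex)
    (L := ((tensorFunctor H.coeff).mapHomologicalComplex _).obj Q.complex)
    { f := fun i => tensorOverMap (sdMap f) (φ.φ i) (coeffToRes f)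
      comm' := fun i j _ => tensorOver_ext fun x a =>
        congrArg (fun z : (Q.complex.X j).V => tmk (B := H.coeff) z a)
          (congrArg (fun g => g.hom x) (φ.comm i j)) } n

/-- `H^n_Γ(G, A) = Ext^n(ℤ, A)`, computed by the relatively projective resolution `P` of `ℤ`: the
cohomology of `Hom_{G ⋊ Γ}(P_*, A)`. -/
def cohomology (P : RelResolution G) (n : ℕ) : ModuleCat.{u} ℤ :=
  (P.complex.linearYonedaObj ℤ G.coeff).homology n

/-- The map `H^n_Γ(H, A) → H^n_Γ(G, A)` given by a morphism `f : G ⟶ H`, computed by a map of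
resolutions along `f`. -/
def cohomologyMap {f : G ⟶ H} {P : RelResolution G} {Q : RelResolution H} (φ : Hom f P Q) (n : ℕ) :
    Q.cohomology n ⟶ P.cohomology n :=
  HomologicalComplex.homologyMap
    (K := Q.complex.linearYonedaObj ℤ H.coeff)
    (L := P.complex.linearYonedaObj ℤ G.coeff)
    { f := fun i => ModuleCat.ofHom
        { toFun := fun h : Q.complex.X i ⟶ H.coeff =>
            φ.φ i ≫ Rep.resMap (sdMap f) h ≫ resToCoeff f
          map_add' := fun _ _ => rfl
          map_smul' := fun _ _ => rfl }
      comm' := fun i j _ => by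
        apply ModuleCat.hom_ext
        apply LinearMap.ext
        intro (h : Q.complex.X i ⟶ H.coeff)
        have := φ.comm j i
        change P.complex.d j i ≫ φ.φ i ≫ Rep.resMap (sdMap f) h ≫ resToCoeff f =
          φ.φ j ≫ Rep.resMap (sdMap f) (Q.complex.d j i) ≫ Rep.resMap (sdMap f) h ≫ resToCoeff f
        rw [← Category.assoc, ← this, Category.assoc] } n

end RelResolution
/-! ### Existence of relatively projective resolutions: the homogeneous bar resolution -/

section Bar

variable (G : GammaGroup α)

/-- The free abelian group on `G ^ (n + 1)` with the diagonal action of `G ⋊ Γ`. -/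
def barRep (n : ℕ) : Representation ℤ G.sd ((Fin (n + 1) → G.carrier) →₀ ℤ) where
  toFun s := Finsupp.lmapDomain ℤ ℤ fun x i => G.leftAct s (x i)
  map_one' := by
    ext x y
    simp [leftAct]
  map_mul' s t := by
    ext x y
    simp [leftAct, mul_assoc]

/-- The simplicial `G ⋊ Γ`-module `n ↦ ℤ(G ^ (n + 1))`. -/
def barSimplicial : SimplicialObject (Rep.{u} ℤ G.sd) where
  obj n := Rep.of (G.barRep n.unop.len)
  map θ := Rep.ofHom ⟨Finsupp.lmapDomain ℤ ℤ fun x => x ∘ θ.unop.toOrderHom, fun s => by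
    ext x y
    simp [barRep, Function.comp_def]⟩
  map_id n := by
    apply Rep.hom_ext
    apply Representation.IntertwiningMap.ext
    apply LinearMap.ext
    intro x
    exact Finsupp.mapDomain_id
  map_comp θ φ := by
    apply Rep.hom_ext
    apply Representation.IntertwiningMap.ext
    apply LinearMap.ext
    intro x
    exact Finsupp.mapDomain_comp (f := fun x => x ∘ θ.unop.toOrderHom)
      (g := fun x => x ∘ φ.unop.toOrderHom) (v := x)

/-- The homogeneous bar complex. -/
def barComplex : ChainComplex (Rep.{u} ℤ G.sd) ℕ :=
  (AlgebraicTopology.alternatingFaceMapComplex _).obj G.barSimplicial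

/-- The differential of the bar complex as a linear map. -/
def barD (n : ℕ) : ((Fin (n + 2) → G.carrier) →₀ ℤ) →ₗ[ℤ] ((Fin (n + 1) → G.carrier) →₀ ℤ) :=
  ∑ i : Fin (n + 2), (-1 : ℤ) ^ (i : ℕ) • Finsupp.lmapDomain ℤ ℤ fun x => x ∘ i.succAbove

lemma barComplex_d (n : ℕ) (x : (Fin (n + 2) → G.carrier) →₀ ℤ) :
    (G.barComplex.d (n + 1) n).hom x = G.barD n x := by
  have h : G.barComplex.d (n + 1) n =
      ∑ i : Fin (n + 2), (-1 : ℤ) ^ (i : ℕ) • G.barSimplicial.δ i :=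
    AlgebraicTopology.AlternatingFaceMapComplex.obj_d_eq _ _
  let Φ : (Rep.of (G.barRep (n + 1)) ⟶ Rep.of (G.barRep n)) →+
      (((Fin (n + 2) → G.carrier) →₀ ℤ) →ₗ[ℤ] ((Fin (n + 1) → G.carrier) →₀ ℤ)) :=
    { toFun := fun g => g.hom.toLinearMap
      map_zero' := rfl
      map_add' := fun _ _ => rfl }
  have h2 : Φ (∑ i : Fin (n + 2), (-1 : ℤ) ^ (i : ℕ) • G.barSimplicial.δ i) = G.barD n := by
    refine (map_sum Φ _ _).trans (Finset.sum_congr rfl fun i _ => ?_)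
    exact map_zsmul Φ _ _
  rw [h]
  exact LinearMap.congr_fun h2 x

lemma barD_single (n : ℕ) (x : Fin (n + 2) → G.carrier) :
    G.barD n (Finsupp.single x 1) =
      ∑ i : Fin (n + 2), (-1 : ℤ) ^ (i : ℕ) • Finsupp.single (x ∘ i.succAbove) (1 : ℤ) := by
  simp [barD, LinearMap.sum_apply]

/-- The contraction `(g_0, …, g_n) ↦ (1, g_0, …, g_n)` -/
def barH (n : ℕ) : ((Fin n → G.carrier) →₀ ℤ) →ₗ[ℤ] ((Fin (n + 1) → G.carrier) →₀ ℤ) :=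
  Finsupp.lmapDomain ℤ ℤ fun x => Fin.cons 1 x

/-- The augmentation. -/
def barε : Rep.of (G.barRep 0) ⟶ G.trivialInt :=
  Rep.ofHom ⟨ULift.moduleEquiv.symm.toLinearMap ∘ₗ
    Finsupp.linearCombination ℤ fun _ => (1 : ℤ), fun s => by
    ext x
    simp [barRep]⟩

lemma barD_barH (n : ℕ) : G.barD (n + 1) ∘ₗ G.barH (n + 2) + G.barH (n + 1) ∘ₗ G.barD n =
    LinearMap.id := by
  refine Finsupp.lhom_ext' fun x => LinearMap.ext_ring ?_
  have h0 : (Fin.cons 1 x : Fin (n + 3) → G.carrier) ∘ (0 : Fin (n + 3)).succAbove = x := by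
    funext j; simp
  have h1 (i : Fin (n + 2)) : (Fin.cons 1 x : Fin (n + 3) → G.carrier) ∘ i.succ.succAbove =
      Fin.cons 1 (x ∘ i.succAbove) := by
    funext j
    refine Fin.cases ?_ (fun j => ?_) j
    · simp
    · simp
  have h2 : G.barH (n + 2) (Finsupp.single x 1) = Finsupp.single (Fin.cons 1 x) 1 := by
    simp [barH]
  have h3 : G.barH (n + 1) (G.barD n (Finsupp.single x 1)) = ∑ i : Fin (n + 2),
      (-1 : ℤ) ^ (i : ℕ) • Finsupp.single (Fin.cons 1 (x ∘ i.succAbove)) (1 : ℤ) := by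
    rw [barD_single, map_sum]
    refine Finset.sum_congr rfl fun i _ => ?_
    rw [map_zsmul]
    simp [barH]
  change G.barD (n + 1) (G.barH (n + 2) (Finsupp.single x 1)) +
    G.barH (n + 1) (G.barD n (Finsupp.single x 1)) = Finsupp.single x 1
  rw [h2, h3, barD_single, Fin.sum_univ_succ, h0]
  simp only [h1, Fin.val_succ, pow_succ, Fin.val_zero, pow_zero, one_smul, mul_neg, mul_one,
    neg_smul, Finset.sum_neg_distrib, neg_add_cancel_right]

lemma barD_barH_zero (x : (Fin 1 → G.carrier) →₀ ℤ) (hx : G.barε.hom x = 0) :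
    G.barD 0 (G.barH 1 x) = x := by
  have h : G.barD 0 ∘ₗ G.barH 1 = LinearMap.id -
      (Finsupp.lsingle (fun _ => 1)) ∘ₗ (Finsupp.linearCombination ℤ fun _ => (1 : ℤ)) := by
    refine Finsupp.lhom_ext' fun x => LinearMap.ext_ring ?_
    have h2 : G.barH 1 (Finsupp.single x 1) = Finsupp.single (Fin.cons 1 x) 1 := by
      simp [barH]
    change G.barD 0 (G.barH 1 (Finsupp.single x 1)) = _
    have h0 : (Fin.cons 1 x : Fin 2 → G.carrier) ∘ (0 : Fin 2).succAbove = x := by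
      funext j; simp
    have h1 : (Fin.cons 1 x : Fin 2 → G.carrier) ∘ (1 : Fin 2).succAbove = fun _ => 1 := by
      funext j
      obtain rfl : j = 0 := Subsingleton.elim _ _
      rfl
    rw [h2, barD_single, Fin.sum_univ_two, h0, h1]
    simp [sub_eq_add_neg]
  have hx' : Finsupp.linearCombination ℤ (fun _ => (1 : ℤ)) x = 0 := congrArg ULift.down hx
  refine (LinearMap.congr_fun h x).trans ?_
  simp [hx']

lemma barRep_isRelFree (n : ℕ) : IsRelFree (Rep.of (G.barRep n)) := by
  let s : Set ((Fin (n + 1) → G.carrier) →₀ ℤ) := {m | ∃ y, y 0 = 1 ∧ m = Finsupp.single y 1}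
  have hs (p : G.carrier × s) : ∃ y : Fin (n + 1) → G.carrier, y 0 = 1 ∧
      p.2.1 = Finsupp.single y 1 := p.2.2
  choose y hy0 hy using hs
  let e (p : G.carrier × s) : Fin (n + 1) → G.carrier := fun i => p.1 * y p i
  have he (p : G.carrier × s) : G.barRep n (SemidirectProduct.inl p.1) p.2.1 =
      Finsupp.single (e p) 1 := by
    rw [hy p]
    simp [barRep, leftAct, e]
  have he' : (fun p : G.carrier × s => G.barRep n (SemidirectProduct.inl p.1) p.2.1) =
      (Finsupp.basisSingleOne (R := ℤ)) ∘ e := by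
    funext p
    simp [he]
  have hinj : Function.Injective e := by
    intro p q hpq
    have h1 : p.1 = q.1 := by simpa [e, hy0] using congrFun hpq 0
    have h2 : y p = y q := by
      funext i
      simpa [e, h1] using congrFun hpq i
    refine Prod.ext h1 (Subtype.ext ?_)
    rw [hy p, hy q, h2]
  have hsurj : Function.Surjective e := by
    intro x
    let p : G.carrier × s := (x 0, ⟨Finsupp.single (fun i => (x 0)⁻¹ * x i) 1,
      fun i => (x 0)⁻¹ * x i, by simp, rfl⟩)
    have hp : (fun i => (x 0)⁻¹ * x i) = y p :=
      Finsupp.single_left_injective (one_ne_zero) (hy p)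
    refine ⟨p, funext fun i => ?_⟩
    simp only [e, ← hp]
    simp [p]
  refine ⟨s, ?_, ?_, ?_⟩
  · rintro σ _ ⟨y, hy, rfl⟩
    refine ⟨fun i => G.act σ (y i), by simp [hy], ?_⟩
    simp [barRep, leftAct]
  · change LinearIndependent ℤ
      (fun p : G.carrier × s => G.barRep n (SemidirectProduct.inl p.1) p.2.1)
    rw [he']
    exact Finsupp.basisSingleOne.linearIndependent.comp e hinj
  · change Submodule.span ℤ (Set.range
      (fun p : G.carrier × s => G.barRep n (SemidirectProduct.inl p.1) p.2.1)) = ⊤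
    rw [he', hsurj.range_comp]
    exact Finsupp.basisSingleOne.span_eq

lemma barH_smul (n : ℕ) (σ : Γ) (x : (Fin (n + 1) → G.carrier) →₀ ℤ) :
    G.barH (n + 1) (G.barRep n (SemidirectProduct.inr σ) x) =
      G.barRep (n + 1) (SemidirectProduct.inr σ) (G.barH (n + 1) x) := by
  have : G.barH (n + 1) ∘ₗ G.barRep n (SemidirectProduct.inr σ) =
      G.barRep (n + 1) (SemidirectProduct.inr σ) ∘ₗ G.barH (n + 1) := by
    refine Finsupp.lhom_ext' fun x => LinearMap.ext_ring ?_
    have h : (Fin.cons 1 (fun i => G.act σ (x i)) : Fin (n + 2) → G.carrier) =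
        fun i => G.act σ ((Fin.cons 1 x : Fin (n + 2) → G.carrier) i) := by
      funext i
      refine Fin.cases ?_ (fun i => ?_) i
      · simp
      · simp
    simp [barH, barRep, leftAct, h]
  exact LinearMap.congr_fun this x

/-- The homogeneous bar resolution. -/
def barResolution : RelResolution G where
  complex := G.barComplex
  ε := G.barε
  d_ε := by
    apply Rep.hom_ext
    apply Representation.IntertwiningMap.ext
    have h : (Finsupp.linearCombination ℤ fun _ => (1 : ℤ)) ∘ₗ G.barD 0 = 0 := by
      refine Finsupp.lhom_ext' fun x => LinearMap.ext_ring ?_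
      simp [barD_single, Fin.sum_univ_two]
    apply LinearMap.ext
    intro x
    exact (congrArg G.barε.hom (G.barComplex_d 0 x)).trans
      (congrArg ULift.up (LinearMap.congr_fun h x))
  projective n := ⟨_, G.barRep_isRelFree n, ⟨Retract.refl _⟩⟩
  split_ε := ⟨fun m => Finsupp.single (fun _ => 1) m.down, fun m _ => by
    refine ⟨?_, fun σ => ?_⟩
    · apply ULift.ext
      change Finsupp.linearCombination ℤ (fun _ => (1 : ℤ)) (Finsupp.single _ m.down) = m.down
      simp
    · change Finsupp.single _ m.down =
        G.barRep 0 (SemidirectProduct.inr σ) (Finsupp.single _ m.down)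
      simp [barRep, leftAct]⟩
  split_zero := ⟨G.barH 1, fun x hx => ⟨(G.barComplex_d 0 _).trans (G.barD_barH_zero x hx),
    fun σ => G.barH_smul 0 σ x⟩⟩
  split_succ n := ⟨G.barH (n + 2), fun x hx => by
    refine ⟨(G.barComplex_d (n + 1) _).trans ?_, fun σ => G.barH_smul (n + 1) σ x⟩
    have h := LinearMap.congr_fun (G.barD_barH n) x
    have hx' : G.barD n x = 0 := (G.barComplex_d n x).symm.trans hx
    refine Eq.trans ?_ h
    change _ = G.barD (n + 1) (G.barH (n + 2) x) + G.barH (n + 1) (G.barD n x)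
    rw [hx', map_zero, add_zero]⟩

instance : Nonempty (RelResolution G) := ⟨G.barResolution⟩

end Bar

end GammaGroup
end
end EquivariantHomology

open EquivariantHomology CotripleResolution

universe u

/-! The homogeneous bar resolution `B_n = ℤ(G^(n+1))` computes both sides. Write `S` for either of
the coefficient functors `- ⊗ A` and `Hom(-, A)`, the latter regarded as covariant with values in
the opposite category, so that a single argument serves homology and cohomology.

Drop `B_0`: the complex `⋯ → S(B_2) → S(B_1)` is augmented to `S(I(G))` by `(x_0, x_1) ↦ x_1 - x_0`.
The cotriple complex of the functor `S(I(-))` has the same augmentation target. Both are acyclic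
models for the free cotriple `F`: every term at `G` is a natural retract of the term at `F(G)`, and
at `F(G)` the augmented complex has a contraction, natural along maps `F(f)`. For the cotriple
complex both facts come from the comultiplication (`cotripleAcyclicModel`). For the bar complex
(`barAcyclicModel`):

- the retraction comes from `(x_i) ↦ (|x_0⁻¹ x_i|)`, corrected by `x_0⁻¹` on `A`. Although `G →
F(G)` is not a homomorphism, this is well defined after tensoring with `A` or mapping into `A`,
since normalising by `x_0` removes the translation by `G`; - the contraction comes from the freeness
of `I(F(X))` on the elements `|x| - 1`: the crossed homomorphism `fox` with `|x| ↦ (1, |x|)` splits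
`B_1 → I` equivariantly, and cones `x ↦ (x_0, u x)` extend this splitting to all degrees.

Acyclic models (`AcyclicModel.exists_homotopyEquiv`) then give a homotopy equivalence natural in
`G`. Truncation lowers the degree by one and leaves homology unchanged away from its bottom degree;
hence the shift from `n` to `n - 1` and the bound `n ≥ 2`.

For arbitrary resolutions, relatively projective modules lift along `Γ`-split epimorphisms, so every
resolution is homotopy equivalent to the bar resolution, compatibly up to homotopy with maps along
`G ⟶ H` (`homologyIso_natural`). Finally `Hom(I(G), A) = Der_Γ(G, A)` through `x ↦ x - 1`. -/

section Comparison

/-! ### Comparison of resolutions from a lifting property -/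

variable {V : Type*} [Category* V] [Preadditive V]

/-- Morphisms out of `X` lift along the differentials of the augmented complex `Q ⟶ N` as soon as
they are cycles: `Q ⟶ N` is exact as seen from `X`. -/
structure LiftsCycles (X : V) (Q : ChainComplex V ℕ) {N : V} (ε : Q.X 0 ⟶ N) : Prop where
  lift_ε : ∀ g : X ⟶ N, ∃ h : X ⟶ Q.X 0, h ≫ ε = g
  lift_zero : ∀ g : X ⟶ Q.X 0, g ≫ ε = 0 → ∃ h : X ⟶ Q.X 1, h ≫ Q.d 1 0 = g
  lift_succ : ∀ (n : ℕ) (g : X ⟶ Q.X (n + 1)), g ≫ Q.d (n + 1) n = 0 →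
    ∃ h : X ⟶ Q.X (n + 2), h ≫ Q.d (n + 2) (n + 1) = g

namespace LiftsCycles

variable {P Q : ChainComplex V ℕ} {M N : V} {εP : P.X 0 ⟶ M} {εQ : Q.X 0 ⟶ N}

/-- The usual degreewise construction. Only the lifting property enters, with no kernels or
projectives of the ambient category, so that it applies both to modules with relative splittings and
to categories of functors. -/
theorem exists_chainMap (h : ∀ n, LiftsCycles (P.X n) Q εQ) (hP : P.d 1 0 ≫ εP = 0) (m : M ⟶ N) :
    ∃ φ : P ⟶ Q, φ.f 0 ≫ εQ = εP ≫ m := by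
  choose z hz using (h 0).lift_ε (εP ≫ m)
  choose o ho using (h 1).lift_zero (P.d 1 0 ≫ z) (by
    rw [Category.assoc, hz, reassoc_of% hP, Limits.zero_comp])
  refine ⟨ChainComplex.mkHom P Q z o ho fun n p => ?_, hz⟩
  have := (h (n + 2)).lift_succ n (P.d (n + 2) (n + 1) ≫ p.2.1) (by
    rw [Category.assoc, p.2.2, P.d_comp_d_assoc, Limits.zero_comp])
  exact ⟨this.choose, this.choose_spec⟩

theorem homotopy_zero (h : ∀ n, LiftsCycles (P.X n) Q εQ) (φ : P ⟶ Q) (hφ : φ.f 0 ≫ εQ = 0) :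
    Nonempty (Homotopy φ 0) := by
  choose z hz using (h 0).lift_zero (φ.f 0) hφ
  choose o ho using (h 1).lift_succ 0 (φ.f 1 - P.d 1 0 ≫ z) (by
    rw [Preadditive.sub_comp, Category.assoc, hz, φ.comm, sub_self])
  refine ⟨Homotopy.mkInductive φ z hz.symm o (by rw [ho]; abel) fun n p => ?_⟩
  -- The part of `φ` not yet accounted for is a cycle by the homotopy relation one degree lower
  -- (`p.2.2`); a lift of it is the next component.
  have := (h (n + 2)).lift_succ (n + 1) (φ.f (n + 2) - P.d (n + 2) (n + 1) ≫ p.2.1) (by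
    have h2 : p.2.1 ≫ Q.d (n + 2) (n + 1) = φ.f (n + 1) - P.d (n + 1) n ≫ p.1 := by
      have := p.2.2
      exact eq_sub_of_add_eq' this.symm
    rw [Preadditive.sub_comp, Category.assoc, h2, φ.comm, Preadditive.comp_sub,
      P.d_comp_d_assoc, Limits.zero_comp, sub_zero, sub_self])
  exact ⟨this.choose, by rw [this.choose_spec]; abel⟩

theorem homotopy (h : ∀ n, LiftsCycles (P.X n) Q εQ) (φ ψ : P ⟶ Q)
    (hφ : φ.f 0 ≫ εQ = ψ.f 0 ≫ εQ) : Nonempty (Homotopy φ ψ) := by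
  obtain ⟨k⟩ := homotopy_zero h (φ - ψ) (by
    rw [HomologicalComplex.sub_f_apply, Preadditive.sub_comp, hφ, sub_self])
  exact ⟨Homotopy.equivSubZero.symm k⟩

theorem exists_homotopyEquiv {εQ : Q.X 0 ⟶ M} (hPQ : ∀ n, LiftsCycles (P.X n) Q εQ)
    (hQP : ∀ n, LiftsCycles (Q.X n) P εP) (hPP : ∀ n, LiftsCycles (P.X n) P εP)
    (hQQ : ∀ n, LiftsCycles (Q.X n) Q εQ) (hP : P.d 1 0 ≫ εP = 0) (hQ : Q.d 1 0 ≫ εQ = 0) :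
    ∃ e : HomotopyEquiv P Q, e.hom.f 0 ≫ εQ = εP := by
  obtain ⟨a, ha⟩ := exists_chainMap hPQ hP (𝟙 M)
  obtain ⟨b, hb⟩ := exists_chainMap hQP hQ (𝟙 M)
  rw [Category.comp_id] at ha hb
  obtain ⟨k⟩ := homotopy hPP (a ≫ b) (𝟙 P) (by simp [ha, hb])
  obtain ⟨l⟩ := homotopy hQQ (b ≫ a) (𝟙 Q) (by simp [ha, hb])
  exact ⟨⟨a, b, k, l⟩, ha⟩

end LiftsCycles

end Comparison

/-! ### Acyclic models for a comonad -/

namespace CotripleResolution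

variable {C : Type*} [Category* C] {D : Type*} [Category* D] [Preadditive D]

/-- A functor with values in chain complexes as a complex of functors. -/
@[simps]
def complexOfFunctors (K : C ⥤ ChainComplex D ℕ) : ChainComplex (C ⥤ D) ℕ where
  X n := K ⋙ HomologicalComplex.eval D _ n
  d i j :=
    { app := fun X => (K.obj X).d i j
      naturality := fun X Y f => (K.map f).comm i j }
  shape i j h := by
    ext X
    exact (K.obj X).shape i j h
  d_comp_d' i j k _ _ := by
    ext X
    exact (K.obj X).d_comp_d i j k

/-- The chain map, natural in `X`, of a morphism of complexes of functors. -/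
@[simps]
def natTransOfHom {K L : C ⥤ ChainComplex D ℕ} (φ : complexOfFunctors K ⟶ complexOfFunctors L) :
    K ⟶ L where
  app X :=
    { f := fun n => (φ.f n).app X
      comm' := fun i j _ => congr_app (φ.comm i j) X }
  naturality X Y f := by
    ext n
    exact (φ.f n).naturality f

/-- Evaluation at `X` is an additive functor carrying `complexOfFunctors K` to `K.obj X`, hence it
carries homotopies to homotopies. -/
lemma homologyMap_natTransOfHom {D : Type*} [Category* D] [Abelian D]
    {K L : C ⥤ ChainComplex D ℕ} {φ ψ : complexOfFunctors K ⟶ complexOfFunctors L}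
    (h : Homotopy φ ψ) (n : ℕ) (X : C) :
    HomologicalComplex.homologyMap ((natTransOfHom φ).app X) n =
      HomologicalComplex.homologyMap ((natTransOfHom ψ).app X) n := by
  have k : Homotopy ((natTransOfHom φ).app X) ((natTransOfHom ψ).app X) :=
    ((evaluation C D).obj X).mapHomotopy h
  exact k.homologyMap_eq n

/-- The homology functors of two functors to chain complexes whose complexes of functors are homotopy
equivalent. -/
noncomputable def homologyIso {D : Type*} [Category* D] [Abelian D]
    {K L : C ⥤ ChainComplex D ℕ}
    (e : HomotopyEquiv (complexOfFunctors K) (complexOfFunctors L)) (n : ℕ) :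
    K ⋙ HomologicalComplex.homologyFunctor D _ n ≅ L ⋙ HomologicalComplex.homologyFunctor D _ n where
  hom := Functor.whiskerRight (natTransOfHom e.hom) _
  inv := Functor.whiskerRight (natTransOfHom e.inv) _
  hom_inv_id := by
    ext X
    refine (HomologicalComplex.homologyMap_comp _ _ n).symm.trans ?_
    exact (homologyMap_natTransOfHom e.homotopyHomInvId n X).trans
      (HomologicalComplex.homologyMap_id _ n)
  inv_hom_id := by
    ext X
    refine (HomologicalComplex.homologyMap_comp _ _ n).symm.trans ?_
    exact (homologyMap_natTransOfHom e.homotopyInvHomId n X).trans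
      (HomologicalComplex.homologyMap_id _ n)

/-- An augmented functor `K ⟶ T` to chain complexes which is presentable with respect to the comonad
`W` (each `K_n` is naturally a retract of `K_n W`) and contractible on free objects (`K W ⟶ T W` has a
natural contraction). -/
structure AcyclicModel (W : Comonad C) (T : C ⥤ D) (K : C ⥤ ChainComplex D ℕ) where
  /-- the augmentation -/
  ε : ∀ X, (K.obj X).X 0 ⟶ T.obj X
  ε_natural : ∀ {X Y} (f : X ⟶ Y), (K.map f).f 0 ≫ ε Y = ε X ≫ T.map f
  d_ε : ∀ X, (K.obj X).d 1 0 ≫ ε X = 0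
  /-- the presentation -/
  θ : ∀ n X, (K.obj X).X n ⟶ (K.obj (W.obj X)).X n
  θ_natural : ∀ n {X Y} (f : X ⟶ Y), (K.map f).f n ≫ θ n Y = θ n X ≫ (K.map (W.map f)).f n
  θ_ε : ∀ n X, θ n X ≫ (K.map (W.ε.app X)).f n = 𝟙 _
  /-- the contraction in degree `-1` -/
  sε : ∀ X, T.obj (W.obj X) ⟶ (K.obj (W.obj X)).X 0
  -- Naturality is required along maps `W.map f` only: a contraction on free objects may depend on
  -- the chosen generators.
  sε_natural : ∀ {X Y} (f : X ⟶ Y), T.map (W.map f) ≫ sε Y = sε X ≫ (K.map (W.map f)).f 0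
  /-- the contraction -/
  s : ∀ n X, (K.obj (W.obj X)).X n ⟶ (K.obj (W.obj X)).X (n + 1)
  s_natural : ∀ n {X Y} (f : X ⟶ Y),
    (K.map (W.map f)).f n ≫ s n Y = s n X ≫ (K.map (W.map f)).f (n + 1)
  sε_ε : ∀ X, sε X ≫ ε (W.obj X) = 𝟙 _
  s_zero : ∀ X, s 0 X ≫ (K.obj (W.obj X)).d 1 0 + ε (W.obj X) ≫ sε X = 𝟙 _
  s_succ : ∀ n X, s (n + 1) X ≫ (K.obj (W.obj X)).d (n + 2) (n + 1) +
    (K.obj (W.obj X)).d (n + 1) n ≫ s n X = 𝟙 _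

namespace AcyclicModel

variable {W : Comonad C} {T : C ⥤ D} {K L : C ⥤ ChainComplex D ℕ}

/-- The augmentation as a morphism of functors. -/
def aug (k : AcyclicModel W T K) : (complexOfFunctors K).X 0 ⟶ T where
  app := k.ε
  naturality _ _ f := k.ε_natural f

/-- A natural map `γ : K_n ⟶ S` that lifts along `u : R ⟶ S` on free objects lifts along `u`. -/
lemma exists_lift (k : AcyclicModel W T K) (n : ℕ) {R S : C ⥤ D} (u : R ⟶ S)
    (γ : ∀ X, (K.obj X).X n ⟶ S.obj X)
    (hγ : ∀ {X Y} (f : X ⟶ Y), (K.map f).f n ≫ γ Y = γ X ≫ S.map f)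
    (t : ∀ X, S.obj (W.obj X) ⟶ R.obj (W.obj X))
    (ht : ∀ {X Y} (f : X ⟶ Y), S.map (W.map f) ≫ t Y = t X ≫ R.map (W.map f))
    (h : ∀ X, γ (W.obj X) ≫ t X ≫ u.app (W.obj X) = γ (W.obj X)) :
    ∃ v : (complexOfFunctors K).X n ⟶ R, ∀ X, v.app X ≫ u.app X = γ X := by
  have hε {X Y : C} (f : X ⟶ Y) : W.map f ≫ W.ε.app Y = W.ε.app X ≫ f := W.ε.naturality f
  -- Pass to the free object by the presentation, lift there, and return by the counit. The counit
  -- is natural, and `t` is only ever moved past maps of the form `W.map f`.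
  let v (X : C) : (K.obj X).X n ⟶ R.obj X := k.θ n X ≫ γ (W.obj X) ≫ t X ≫ R.map (W.ε.app X)
  refine ⟨⟨v, fun X Y f => ?_⟩, fun X => ?_⟩
  · change (K.map f).f n ≫ v Y = v X ≫ R.map f
    simp only [v, Category.assoc]
    rw [reassoc_of% (k.θ_natural n f), reassoc_of% (hγ (W.map f)), reassoc_of% (ht f)]
    erw [← R.map_comp, ← R.map_comp, hε]
  · change v X ≫ u.app X = γ X
    have h1 : R.map (W.ε.app X) ≫ u.app X = u.app (W.obj X) ≫ S.map (W.ε.app X) :=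
      u.naturality (W.ε.app X)
    have h2 : (K.map (W.ε.app X)).f n ≫ γ X = γ (W.obj X) ≫ S.map (W.ε.app X) := hγ _
    have h3 : k.θ n X ≫ (K.map (W.ε.app X)).f n = 𝟙 _ := k.θ_ε n X
    simp only [v, Category.assoc]
    erw [h1]
    rw [reassoc_of% (h X)]
    exact (congrArg _ h2.symm).trans
      ((Category.assoc _ _ _).symm.trans ((congrArg (· ≫ γ X) h3).trans (Category.id_comp _)))

/-- On a cycle the second term of the contraction identity vanishes, so `s` produces a preimage
under `d`. -/
lemma comp_eq_self_of_contraction {X Y Z U : D} {a : U ⟶ Y} {b : Y ⟶ Z} {s' : Z ⟶ Y} {s : Y ⟶ X}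
    {d : X ⟶ Y} (h0 : a ≫ b = 0) (h : s ≫ d + b ≫ s' = 𝟙 _) : a ≫ s ≫ d = a := by
  rw [← eq_sub_iff_add_eq] at h
  rw [h, Preadditive.comp_sub, reassoc_of% h0, Limits.zero_comp, sub_zero, Category.comp_id]

lemma liftsCycles (k : AcyclicModel W T K) (l : AcyclicModel W T L) (n : ℕ) :
    LiftsCycles ((complexOfFunctors K).X n) (complexOfFunctors L) l.aug where
  lift_ε g := by
    obtain ⟨v, hv⟩ := k.exists_lift n l.aug g.app (fun f => g.naturality f) l.sε l.sε_natural fun X =>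
      (congrArg _ (l.sε_ε X)).trans (Category.comp_id _)
    exact ⟨v, NatTrans.ext (funext hv)⟩
  lift_zero g hg := by
    obtain ⟨v, hv⟩ := k.exists_lift n ((complexOfFunctors L).d 1 0) g.app (fun f => g.naturality f)
      (l.s 0) (l.s_natural 0) fun X =>
        comp_eq_self_of_contraction (congr_app hg (W.obj X)) (l.s_zero X)
    exact ⟨v, NatTrans.ext (funext hv)⟩
  lift_succ m g hg := by
    obtain ⟨v, hv⟩ := k.exists_lift n ((complexOfFunctors L).d (m + 2) (m + 1)) g.app (fun f => g.naturality f)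
      (l.s (m + 1)) (l.s_natural (m + 1)) fun X =>
        comp_eq_self_of_contraction (congr_app hg (W.obj X)) (l.s_succ m X)
    exact ⟨v, NatTrans.ext (funext hv)⟩

/-- The acyclic models theorem. -/
theorem exists_homotopyEquiv (k : AcyclicModel W T K) (l : AcyclicModel W T L) :
    Nonempty (HomotopyEquiv (complexOfFunctors K) (complexOfFunctors L)) := by
  obtain ⟨e, -⟩ := LiftsCycles.exists_homotopyEquiv (εP := k.aug) (εQ := l.aug)
    (k.liftsCycles l) (l.liftsCycles k) (k.liftsCycles k) (l.liftsCycles l)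
    (NatTrans.ext (funext k.d_ε)) (NatTrans.ext (funext l.d_ε))
  exact ⟨e⟩

end AcyclicModel

end CotripleResolution

/-! ### The cotriple complex as an acyclic model -/

namespace CotripleResolution

section AlternatingSums

variable {D : Type*} [Category* D] [Preadditive D]

lemma zsmul_comp_comm {X Y X' Y' : D} {a : X ⟶ Y} {b : Y ⟶ Y'} {c : X ⟶ X'} {d : X' ⟶ Y'}
    (h : a ≫ b = c ≫ d) (m : ℤ) : a ≫ (m • b) = (m • c) ≫ d := by
  rw [Preadditive.comp_zsmul, Preadditive.zsmul_comp, h]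

lemma alternatingSum_comp_eq_zero {X Y Z : D} {f : Fin 2 → (X ⟶ Y)} {g : Y ⟶ Z}
    (h : f 0 ≫ g = f 1 ≫ g) : (∑ i : Fin 2, (-1 : ℤ) ^ (i : ℕ) • f i) ≫ g = 0 := by
  simp [Fin.sum_univ_two, Preadditive.add_comp, h]

/-- The extra degeneracy sits at the last face, which carries the sign `(-1)^(n+1)`; the sign on `t`
turns this term into the identity, and the remaining faces cancel against the second summand. -/
lemma alternatingSum_contraction {X Y Z : D} (n : ℕ) {f : Fin (n + 2) → (Z ⟶ Y)}
    {g : Fin (n + 1) → (Y ⟶ X)} {s : X ⟶ Y} {t : Y ⟶ Z}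
    (h : ∀ i : Fin (n + 1), t ≫ f i.castSucc = g i ≫ s) (h1 : t ≫ f (Fin.last _) = 𝟙 _) :
    ((-1 : ℤ) ^ (n + 1) • t) ≫ (∑ i : Fin (n + 2), (-1 : ℤ) ^ (i : ℕ) • f i) +
      (∑ i : Fin (n + 1), (-1 : ℤ) ^ (i : ℕ) • g i) ≫ ((-1 : ℤ) ^ n • s) = 𝟙 _ := by
  have h2 : (-1 : ℤ) ^ (n + 1) * (-1 : ℤ) ^ (n + 1) = 1 := by
    rw [← pow_add]
    exact Even.neg_one_pow ⟨n + 1, rfl⟩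
  rw [Fin.sum_univ_castSucc, Preadditive.zsmul_comp, Preadditive.comp_zsmul, Preadditive.comp_add,
    Preadditive.comp_sum, Preadditive.sum_comp]
  simp only [Preadditive.comp_zsmul, Preadditive.zsmul_comp, h, h1, Fin.val_castSucc, Fin.val_last]
  rw [smul_add, smul_smul, h2, one_smul, pow_succ, mul_neg_one, neg_smul, add_right_comm,
    neg_add_cancel, zero_add]

end AlternatingSums

section Cotriple

variable {C : Type*} [Category* C] (W : Comonad C)

/-- The extra degeneracy `W^n δ : W ^ n (W X) ⟶ W ^ (n + 1) (W X)`. -/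
def extraDegeneracy : ∀ n, W.toFunctor ⋙ iter W n ⟶ W.toFunctor ⋙ iter W (n + 1)
  | 0 => W.δ
  | n + 1 => Functor.whiskerRight (extraDegeneracy n) W.toFunctor

/-- The degeneracy acts on the innermost factor, so it passes the outermost face by naturality of
the counit and the other faces by applying `W`. -/
lemma extraDegeneracy_face (X : C) : ∀ (n : ℕ) (i : Fin (n + 1)),
    (extraDegeneracy W (n + 1)).app X ≫ (face W (n + 1) i.castSucc).app (W.obj X) =
      (face W n i).app (W.obj X) ≫ (extraDegeneracy W n).app X
  | n, ⟨0, _⟩ => by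
    have h := W.ε.naturality ((extraDegeneracy W n).app X)
    cases n <;> exact h
  | n + 1, ⟨i + 1, hi⟩ =>
    (W.map_comp _ _).symm.trans ((congrArg _
      (extraDegeneracy_face X n ⟨i, Nat.lt_of_succ_lt_succ hi⟩)).trans (W.map_comp _ _))

lemma extraDegeneracy_face_last (X : C) : ∀ n : ℕ,
    (extraDegeneracy W n).app X ≫ (face W n (Fin.last n)).app (W.obj X) = 𝟙 _
  | 0 => W.left_counit X
  | n + 1 => (W.map_comp _ _).symm.trans
      ((congrArg _ (extraDegeneracy_face_last X n)).trans (W.map_id _))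

/-- The natural map `W^n δ : W ^ (n + 1) X ⟶ W ^ (n + 1) (W X)`. -/
def presentation : ∀ n, iter W (n + 1) ⟶ W.toFunctor ⋙ iter W (n + 1)
  | 0 => W.δ
  | n + 1 => Functor.whiskerRight (presentation n) W.toFunctor

/-- As a map, `presentation` is `extraDegeneracy` with the factors grouped differently. The
retraction rests on the right counit law, the contraction on the left one. -/
lemma presentation_counit (X : C) : ∀ n : ℕ,
    (presentation W n).app X ≫ (iter W (n + 1)).map (W.ε.app X) = 𝟙 _
  | 0 => W.right_counit X
  | n + 1 => (W.map_comp _ _).symm.trans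
      ((congrArg _ (presentation_counit X n)).trans (W.map_id _))

variable {D : Type*} [Category* D] [Abelian D] (T : C ⥤ D)

/-- The chain complex of the simplicial object `T (W_* X)`. -/
noncomputable def cotripleComplex : C ⥤ ChainComplex D ℕ :=
  resolution W ⋙ (SimplicialObject.whiskering C D).obj T ⋙
    AlgebraicTopology.alternatingFaceMapComplex D

lemma cotripleComplex_d (X : C) (n : ℕ) : ((cotripleComplex W T).obj X).d (n + 1) n =
    ∑ i : Fin (n + 2), (-1 : ℤ) ^ (i : ℕ) • T.map ((face W (n + 1) i).app X) := by
  refine (AlgebraicTopology.AlternatingFaceMapComplex.obj_d_eq _ _).trans ?_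
  refine Finset.sum_congr rfl fun i _ => ?_
  exact congrArg (fun v => (-1 : ℤ) ^ (i : ℕ) • T.map v) (resolution_δ W X n i)

/-- The cotriple complex is an acyclic model. -/
noncomputable def cotripleAcyclicModel : AcyclicModel W T (cotripleComplex W T) where
  ε X := T.map (W.ε.app X)
  ε_natural f := (T.map_comp _ _).symm.trans
    ((congrArg _ (W.ε.naturality f)).trans (T.map_comp _ _))
  d_ε X := (congrArg (· ≫ T.map (W.ε.app X)) (cotripleComplex_d W T X 0)).trans
    (alternatingSum_comp_eq_zero ((T.map_comp _ _).symm.trans ((congrArg T.map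
      (W.ε.naturality (W.ε.app X)).symm).trans (T.map_comp _ _))))
  θ n X := T.map ((presentation W n).app X)
  θ_natural n X Y f := (T.map_comp _ _).symm.trans
    ((congrArg _ ((presentation W n).naturality f)).trans (T.map_comp _ _))
  θ_ε n X := (T.map_comp _ _).symm.trans
    ((congrArg _ (presentation_counit W X n)).trans (T.map_id _))
  sε X := T.map ((extraDegeneracy W 0).app X)
  sε_natural f := (T.map_comp _ _).symm.trans
    ((congrArg _ ((extraDegeneracy W 0).naturality f)).trans (T.map_comp _ _))
  s n X := (-1 : ℤ) ^ (n + 1) • T.map ((extraDegeneracy W (n + 1)).app X)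
  s_natural n X Y f := zsmul_comp_comm ((T.map_comp _ _).symm.trans
    ((congrArg _ ((extraDegeneracy W (n + 1)).naturality f)).trans (T.map_comp _ _))) _
  sε_ε X := (T.map_comp _ _).symm.trans
    ((congrArg _ (extraDegeneracy_face_last W X 0)).trans (T.map_id _))
  s_zero X := by
    rw [cotripleComplex_d]
    have h := alternatingSum_contraction 0
      (f := fun i => T.map ((face W 1 i).app (W.obj X)))
      (g := fun i => T.map ((face W 0 i).app (W.obj X)))
      (s := T.map ((extraDegeneracy W 0).app X)) (t := T.map ((extraDegeneracy W 1).app X))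
      (fun i => (T.map_comp _ _).symm.trans ((congrArg T.map (extraDegeneracy_face W X 0 i)).trans
        (T.map_comp _ _)))
      ((T.map_comp _ _).symm.trans ((congrArg _ (extraDegeneracy_face_last W X 1)).trans
        (T.map_id _)))
    rw [Fin.sum_univ_one, Fin.val_zero, pow_zero, one_smul, one_smul] at h
    exact h
  s_succ n X := by
    rw [cotripleComplex_d, cotripleComplex_d]
    exact alternatingSum_contraction (n + 1)
      (fun i => (T.map_comp _ _).symm.trans ((congrArg T.map
        (extraDegeneracy_face W X (n + 1) i)).trans (T.map_comp _ _)))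
      ((T.map_comp _ _).symm.trans ((congrArg _ (extraDegeneracy_face_last W X (n + 2))).trans
        (T.map_id _)))

end Cotriple

end CotripleResolution

/-! ### Crossed homomorphisms on a free group -/

namespace FreeGroup

variable {S M : Type*} [AddCommGroup M] (ρ : Representation ℤ (FreeGroup S) M)

/-- Crossed homomorphisms on a free group are determined by their values on the generators. -/
lemma crossedHom_ext {d e : FreeGroup S → M} (hd : ∀ x y, d (x * y) = d x + ρ x (d y))
    (he : ∀ x y, e (x * y) = e x + ρ x (e y)) (h : ∀ s, d (of s) = e (of s)) : d = e := by
  have h1 {d : FreeGroup S → M} (hd : ∀ x y, d (x * y) = d x + ρ x (d y)) : d 1 = 0 := by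
    have := hd 1 1
    simpa using this
  funext w
  induction w using FreeGroup.induction_on with
  | C1 => rw [h1 hd, h1 he]
  | of s => exact h s
  | inv_of s hs =>
    have h2 {d : FreeGroup S → M} (hd : ∀ x y, d (x * y) = d x + ρ x (d y)) (x) :
        d x⁻¹ = - ρ x⁻¹ (d x) := by
      have := hd x⁻¹ x
      rw [inv_mul_cancel, h1 hd] at this
      exact eq_neg_of_add_eq_zero_left this.symm
    rw [h2 hd, h2 he, hs]
  | mul x y hx hy => rw [hd, he, hx, hy]

variable (v : S → M)

/-- The affine action of the free group on `M` with linear part `ρ` and translation parts `v`. -/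
def affineAction : FreeGroup S →* Equiv.Perm M :=
  lift fun s =>
    { toFun := fun m => v s + ρ (of s) m
      invFun := fun m => ρ (of s)⁻¹ (m - v s)
      left_inv := fun m => by simp
      right_inv := fun m => by simp }

/-- The crossed homomorphism with prescribed values on the generators. -/
def crossedHom (w : FreeGroup S) : M := affineAction ρ v w 0

/-- A crossed homomorphism is the translation part of an affine action. Generators act by invertible
affine maps, so the universal property of the free group yields the action, and its multiplicativity
is the cocycle rule. -/
lemma affineAction_apply (w : FreeGroup S) : ∀ m, affineAction ρ v w m = crossedHom ρ v w + ρ w m := by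
  induction w using FreeGroup.induction_on with
  | C1 => intro m; simp [crossedHom]
  | of s => intro m; simp [crossedHom, affineAction]
  | inv_of s hs => intro m; simp [crossedHom, affineAction, sub_eq_neg_add]
  | mul x y hx hy =>
    intro m
    have h : crossedHom ρ v (x * y) = crossedHom ρ v x + ρ x (crossedHom ρ v y) := by
      rw [← hx, crossedHom, _root_.map_mul]
      rfl
    rw [_root_.map_mul, Equiv.Perm.mul_apply, hy, hx, h]
    simp [add_assoc]

lemma crossedHom_mul (x y : FreeGroup S) :
    crossedHom ρ v (x * y) = crossedHom ρ v x + ρ x (crossedHom ρ v y) := by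
  rw [← affineAction_apply, crossedHom, _root_.map_mul]
  rfl

lemma crossedHom_of (s : S) : crossedHom ρ v (of s) = v s := by
  simp [crossedHom, affineAction]

end FreeGroup

/-! ### Bar complexes: cones, boundaries and Fox derivatives -/

namespace EquivariantHomology

noncomputable section

variable {Γ : Type u} [Group Γ] {A : Type u} [AddCommGroup A]

namespace GammaGroup

variable {α : Representation ℤ Γ A} {G H : GammaGroup α}

/-- The linear map between bar modules induced by a map of sets. -/
def barMapLin (φ : G.carrier → H.carrier) (n : ℕ) :
    ((Fin n → G.carrier) →₀ ℤ) →ₗ[ℤ] ((Fin n → H.carrier) →₀ ℤ) :=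
  Finsupp.lmapDomain ℤ ℤ fun x => φ ∘ x

@[simp] lemma barMapLin_single (φ : G.carrier → H.carrier) (n : ℕ) (x : Fin n → G.carrier) (m : ℤ) :
    barMapLin φ n (Finsupp.single x m) = Finsupp.single (φ ∘ x) m := by
  simp [barMapLin]

lemma barD_barMapLin (φ : G.carrier → H.carrier) (n : ℕ) (y : (Fin (n + 2) → G.carrier) →₀ ℤ) :
    H.barD n (barMapLin φ _ y) = barMapLin φ _ (G.barD n y) := by
  have : H.barD n ∘ₗ barMapLin φ _ = barMapLin φ _ ∘ₗ G.barD n := by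
    refine Finsupp.lhom_ext' fun x => LinearMap.ext_ring ?_
    simp [barD_single, Function.comp_assoc]
  exact LinearMap.congr_fun this y

lemma barD_barD (n : ℕ) (y : (Fin (n + 3) → G.carrier) →₀ ℤ) :
    G.barD n (G.barD (n + 1) y) = 0 := by
  have h := G.barComplex.d_comp_d (n + 2) (n + 1) n
  have h2 : (G.barComplex.d (n + 1) n).hom ((G.barComplex.d (n + 2) (n + 1)).hom y) = 0 :=
    congrArg (fun f : G.barComplex.X (n + 2) ⟶ G.barComplex.X n => f.hom y) h
  exact ((congrArg _ (G.barComplex_d (n + 1) y).symm).trans (G.barComplex_d n _).symm).trans h2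

/-- Prepending `g`. -/
def barCons (g : G.carrier) (n : ℕ) :
    ((Fin n → G.carrier) →₀ ℤ) →ₗ[ℤ] ((Fin (n + 1) → G.carrier) →₀ ℤ) :=
  Finsupp.lmapDomain ℤ ℤ fun x => Fin.cons g x

@[simp] lemma barCons_single (g : G.carrier) (n : ℕ) (x : Fin n → G.carrier) (m : ℤ) :
    barCons g n (Finsupp.single x m) = Finsupp.single (Fin.cons g x) m := by
  simp [barCons]

/-- Face `0` deletes the prepended `g` and face `i + 1` is face `i` behind it, with opposite sign.
The identity holds for every `g`, which leaves the choice of vertex free. -/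
lemma barD_barCons (g : G.carrier) (n : ℕ) (y : (Fin (n + 2) → G.carrier) →₀ ℤ) :
    G.barD (n + 1) (barCons g _ y) = y - barCons g _ (G.barD n y) := by
  have : G.barD (n + 1) ∘ₗ barCons g _ = LinearMap.id - barCons g _ ∘ₗ G.barD n := by
    refine Finsupp.lhom_ext' fun x => LinearMap.ext_ring ?_
    have h0 : (Fin.cons g x : Fin (n + 3) → G.carrier) ∘ (0 : Fin (n + 3)).succAbove = x := by
      funext j; simp
    have h1 (i : Fin (n + 2)) : (Fin.cons g x : Fin (n + 3) → G.carrier) ∘ i.succ.succAbove =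
        Fin.cons g (x ∘ i.succAbove) := by
      funext j
      refine Fin.cases ?_ (fun j => ?_) j
      · simp
      · simp
    change G.barD (n + 1) (barCons g _ (Finsupp.single x 1)) =
      Finsupp.single x 1 - barCons g _ (G.barD n (Finsupp.single x 1))
    rw [barCons_single, barD_single, barD_single, map_sum, Fin.sum_univ_succ, h0]
    simp only [h1, map_zsmul, barCons_single, Fin.val_succ, pow_succ, Fin.val_zero, pow_zero,
      one_smul, mul_neg, mul_one, neg_smul, Finset.sum_neg_distrib, sub_eq_add_neg]
  exact LinearMap.congr_fun this y

lemma barMapLin_barCons (φ : G.carrier → H.carrier) (g : G.carrier) (n : ℕ)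
    (y : (Fin n → G.carrier) →₀ ℤ) :
    barMapLin φ _ (barCons g n y) = barCons (φ g) n (barMapLin φ _ y) := by
  have : barMapLin φ _ ∘ₗ barCons g n = barCons (φ g) n ∘ₗ barMapLin φ _ := by
    refine Finsupp.lhom_ext' fun x => LinearMap.ext_ring ?_
    have h : φ ∘ (Fin.cons g x : Fin (n + 1) → G.carrier) = Fin.cons (φ g) (φ ∘ x) := by
      funext j
      refine Fin.cases ?_ (fun j => ?_) j <;> simp
    simp [h]
  exact LinearMap.congr_fun this y

/-- The linear map `x ↦ (x_0, u x)`: a relative lift of `u` if `u` has values in the cycles. -/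
def barCone {n m : ℕ} (u : ((Fin (n + 1) → G.carrier) →₀ ℤ) →ₗ[ℤ] ((Fin m → G.carrier) →₀ ℤ)) :
    ((Fin (n + 1) → G.carrier) →₀ ℤ) →ₗ[ℤ] ((Fin (m + 1) → G.carrier) →₀ ℤ) :=
  Finsupp.linearCombination ℤ fun x => barCons (x 0) m (u (Finsupp.single x 1))

lemma barCone_single {n m : ℕ}
    (u : ((Fin (n + 1) → G.carrier) →₀ ℤ) →ₗ[ℤ] ((Fin m → G.carrier) →₀ ℤ))
    (x : Fin (n + 1) → G.carrier) :
    barCone u (Finsupp.single x 1) = barCons (x 0) m (u (Finsupp.single x 1)) := by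
  simp [barCone]

/-- The correction term in `barD_barCons` vanishes on cycles. Taking the cone vertex to be `x_0`
instead of `1` costs nothing here and makes the lift compatible with translations. -/
lemma barD_barCone {n m : ℕ}
    (u : ((Fin (n + 1) → G.carrier) →₀ ℤ) →ₗ[ℤ] ((Fin (m + 2) → G.carrier) →₀ ℤ))
    (hu : ∀ y, G.barD m (u y) = 0) (y : (Fin (n + 1) → G.carrier) →₀ ℤ) :
    G.barD (m + 1) (barCone u y) = u y := by
  have : G.barD (m + 1) ∘ₗ barCone u = u := by
    refine Finsupp.lhom_ext' fun x => LinearMap.ext_ring ?_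
    change G.barD (m + 1) (barCone u (Finsupp.single x 1)) = u (Finsupp.single x 1)
    rw [barCone_single, barD_barCons, hu, map_zero, sub_zero]
  exact LinearMap.congr_fun this y

/-- The vertex `x_0` is sent to the vertex of the image tuple by any map of sets. Hence the same
lemma gives equivariance, for the action of an element, and naturality, for a morphism. -/
lemma barMapLin_barCone {n m : ℕ} (φ : G.carrier → H.carrier)
    {u : ((Fin (n + 1) → G.carrier) →₀ ℤ) →ₗ[ℤ] ((Fin m → G.carrier) →₀ ℤ)}
    {u' : ((Fin (n + 1) → H.carrier) →₀ ℤ) →ₗ[ℤ] ((Fin m → H.carrier) →₀ ℤ)}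
    (h : ∀ y, barMapLin φ _ (u y) = u' (barMapLin φ _ y)) (y : (Fin (n + 1) → G.carrier) →₀ ℤ) :
    barMapLin φ _ (barCone u y) = barCone u' (barMapLin φ _ y) := by
  have : barMapLin φ _ ∘ₗ barCone u = barCone u' ∘ₗ barMapLin φ _ := by
    refine Finsupp.lhom_ext' fun x => LinearMap.ext_ring ?_
    change barMapLin φ _ (barCone u (Finsupp.single x 1)) =
      barCone u' (barMapLin φ _ (Finsupp.single x 1))
    rw [barCone_single, barMapLin_barCons, h, barMapLin_single, barCone_single]
    rfl
  exact LinearMap.congr_fun this y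

/-- The boundary `(x_0, x_1) ↦ x_1 - x_0` with values in the group ring. -/
def barToRing (G : GammaGroup α) : ((Fin 2 → G.carrier) →₀ ℤ) →ₗ[ℤ] (G.carrier →₀ ℤ) :=
  Finsupp.lmapDomain ℤ ℤ (fun x : Fin 1 → G.carrier => x 0) ∘ₗ G.barD 0

lemma barToRing_single (x : Fin 2 → G.carrier) :
    G.barToRing (Finsupp.single x 1) = Finsupp.single (x 1) 1 - Finsupp.single (x 0) 1 := by
  rw [barToRing, LinearMap.comp_apply, barD_single, Fin.sum_univ_two, map_add, map_zsmul, map_zsmul]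
  simp [sub_eq_add_neg]

/-- `barToRing` is `barD 0` followed by the injection identifying `G^1` with `G`. -/
lemma barD_zero_eq_zero {y : (Fin 2 → G.carrier) →₀ ℤ} (h : G.barToRing y = 0) :
    G.barD 0 y = 0 := by
  refine Finsupp.mapDomain_injective (f := fun x : Fin 1 → G.carrier => x 0) (fun x y h => ?_)
    (h.trans (map_zero (Finsupp.lmapDomain ℤ ℤ (fun x : Fin 1 → G.carrier => x 0))).symm)
  funext i
  rw [Subsingleton.elim i 0]
  exact h

lemma barToRing_barD (y : (Fin 3 → G.carrier) →₀ ℤ) : G.barToRing (G.barD 1 y) = 0 := by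
  rw [barToRing, LinearMap.comp_apply, barD_barD, map_zero]

lemma augmentation_barToRing (y : (Fin 2 → G.carrier) →₀ ℤ) :
    G.augmentation (G.barToRing y) = 0 := by
  have : G.augmentation ∘ₗ G.barToRing = 0 := by
    refine Finsupp.lhom_ext' fun x => LinearMap.ext_ring ?_
    change G.augmentation (G.barToRing (Finsupp.single x 1)) = 0
    rw [barToRing_single]
    simp [augmentation]
  exact LinearMap.congr_fun this y

lemma barToRing_barMapLin (φ : G.carrier → H.carrier) (y : (Fin 2 → G.carrier) →₀ ℤ) :
    H.barToRing (barMapLin φ _ y) = Finsupp.lmapDomain ℤ ℤ φ (G.barToRing y) := by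
  have : H.barToRing ∘ₗ barMapLin φ _ = Finsupp.lmapDomain ℤ ℤ φ ∘ₗ G.barToRing := by
    refine Finsupp.lhom_ext' fun x => LinearMap.ext_ring ?_
    change H.barToRing (barMapLin φ _ (Finsupp.single x 1)) =
      Finsupp.lmapDomain ℤ ℤ φ (G.barToRing (Finsupp.single x 1))
    rw [barMapLin_single, barToRing_single, barToRing_single, map_sub]
    simp
  exact LinearMap.congr_fun this y

/-! ### The contraction of the bar complex of a free object -/

section Free

variable (X : GammaGroup α)

/-- The generator `|x|` of `F(X)`. -/
def gen (x : X.carrier) : X.freeObj.carrier := FreeGroup.of x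

variable {X} in
lemma freeObj_crossedHom_ext {M : Type*} [AddCommGroup M]
    (ρ : Representation ℤ X.freeObj.carrier M) {d e : X.freeObj.carrier → M}
    (hd : ∀ x y, d (x * y) = d x + ρ x (d y)) (he : ∀ x y, e (x * y) = e x + ρ x (e y))
    (h : ∀ x, d (X.gen x) = e (X.gen x)) : d = e :=
  FreeGroup.crossedHom_ext ρ hd he h

/-- The crossed homomorphism on the free group `F(X)` with `|x| ↦ (1, |x|)`. -/
def fox : X.freeObj.carrier → ((Fin 2 → X.freeObj.carrier) →₀ ℤ) :=
  FreeGroup.crossedHom ((X.freeObj.barRep 1).comp SemidirectProduct.inl) fun x =>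
    Finsupp.single ![1, X.gen x] 1

lemma fox_mul (w w' : X.freeObj.carrier) : X.fox (w * w') =
    X.fox w + X.freeObj.barRep 1 (SemidirectProduct.inl w) (X.fox w') :=
  FreeGroup.crossedHom_mul _ _ _ _

lemma fox_gen (x : X.carrier) : X.fox (X.gen x) = Finsupp.single ![1, X.gen x] 1 :=
  FreeGroup.crossedHom_of _ _ _

/-- The linear extension of `fox`; on the augmentation ideal it is `F(X) ⋊ Γ`-linear. -/
def foxLin : (X.freeObj.carrier →₀ ℤ) →ₗ[ℤ] ((Fin 2 → X.freeObj.carrier) →₀ ℤ) :=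
  Finsupp.linearCombination ℤ X.fox

lemma foxLin_single (w : X.freeObj.carrier) : X.foxLin (Finsupp.single w 1) = X.fox w := by
  simp [foxLin]

lemma groupRing_single (s : G.sd) (x : G.carrier) (m : ℤ) :
    G.groupRing s (Finsupp.single x m) = Finsupp.single (G.leftAct s x) m :=
  Finsupp.mapDomain_single

lemma barRep_single (n : ℕ) (s : G.sd) (x : Fin (n + 1) → G.carrier) (m : ℤ) :
    G.barRep n s (Finsupp.single x m) = Finsupp.single (fun i => G.leftAct s (x i)) m :=
  Finsupp.mapDomain_single

/-- Both sides are crossed homomorphisms into `ℤ(F(X))`, and on a generator both equal `|x| - 1`. -/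
lemma barToRing_fox (w : X.freeObj.carrier) :
    X.freeObj.barToRing (X.fox w) = Finsupp.single w 1 - Finsupp.single 1 1 := by
  let r := X.freeObj.groupRing.comp (SemidirectProduct.inl (φ := X.freeObj.act))
  refine congrFun (freeObj_crossedHom_ext r (d := fun w => X.freeObj.barToRing (X.fox w))
    (e := fun w => Finsupp.single w 1 - Finsupp.single 1 1) ?_ ?_ ?_) w
  · intro x y
    rw [fox_mul, map_add]
    exact congrArg (_ + ·)
      (barToRing_barMapLin (X.freeObj.leftAct (SemidirectProduct.inl x)) (X.fox y))
  · intro x y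
    change _ = _ + X.freeObj.groupRing (SemidirectProduct.inl x)
      (Finsupp.single y 1 - Finsupp.single 1 1)
    rw [map_sub, groupRing_single, groupRing_single]
    simp [leftAct]
  · intro x
    rw [fox_gen, barToRing_single]
    rfl

/-- By linearity from `barToRing_fox`, the composite sends `y` to `y` minus its augmentation times
`1`; so `foxLin` splits the boundary precisely over the augmentation ideal. -/
lemma barToRing_foxLin {y : X.freeObj.carrier →₀ ℤ} (hy : X.freeObj.augmentation y = 0) :
    X.freeObj.barToRing (X.foxLin y) = y := by
  have : X.freeObj.barToRing ∘ₗ X.foxLin = LinearMap.id -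
      (Finsupp.lsingle (1 : X.freeObj.carrier)) ∘ₗ X.freeObj.augmentation := by
    refine Finsupp.lhom_ext' fun x => LinearMap.ext_ring ?_
    change X.freeObj.barToRing (X.foxLin (Finsupp.single x 1)) = Finsupp.single x 1 -
      Finsupp.single 1 (X.freeObj.augmentation (Finsupp.single x 1))
    rw [foxLin_single, barToRing_fox]
    simp [augmentation]
  refine (LinearMap.congr_fun this y).trans ?_
  change y - Finsupp.single _ (X.freeObj.augmentation y) = y
  rw [hy, Finsupp.single_zero, sub_zero]

/-- The contraction `B_{n+1} → B_{n+2}`, where `B` is the bar complex of `F(X)`. -/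
def freeContraction : ∀ n, ((Fin (n + 2) → X.freeObj.carrier) →₀ ℤ) →ₗ[ℤ]
    ((Fin (n + 3) → X.freeObj.carrier) →₀ ℤ)
  | 0 => barCone (LinearMap.id - X.foxLin ∘ₗ X.freeObj.barToRing)
  | n + 1 => barCone (LinearMap.id - freeContraction n ∘ₗ X.freeObj.barD (n + 1))

/-- Since `foxLin` splits the boundary onto the augmentation ideal, `y - foxLin (∂ y)` is a cycle,
and the cone lifts it. -/
lemma barD_freeContraction_zero (y : (Fin 2 → X.freeObj.carrier) →₀ ℤ) :
    X.freeObj.barD 1 (X.freeContraction 0 y) + X.foxLin (X.freeObj.barToRing y) = y := by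
  rw [freeContraction, barD_barCone]
  · exact sub_add_cancel _ _
  intro y
  apply barD_zero_eq_zero
  refine (map_sub _ _ _).trans (sub_eq_zero.2 ?_)
  exact (X.barToRing_foxLin (augmentation_barToRing y)).symm

/-- The contraction identity one degree lower, applied to a boundary, says that `y - s (∂ y)` is a
cycle; the cone then lifts it. -/
lemma barD_freeContraction_succ (n : ℕ) (y : (Fin (n + 3) → X.freeObj.carrier) →₀ ℤ) :
    X.freeObj.barD (n + 2) (X.freeContraction (n + 1) y) +
      X.freeContraction n (X.freeObj.barD (n + 1) y) = y := by
  induction n with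
  | zero =>
    change X.freeObj.barD 2 (barCone (LinearMap.id - X.freeContraction 0 ∘ₗ X.freeObj.barD 1) y) +
      X.freeContraction 0 (X.freeObj.barD 1 y) = y
    rw [barD_barCone]
    · exact sub_add_cancel _ _
    intro y
    refine (map_sub _ _ _).trans (sub_eq_zero.2 ?_)
    have h := X.barD_freeContraction_zero (X.freeObj.barD 1 y)
    rw [barToRing_barD, map_zero, add_zero] at h
    exact h.symm
  | succ n ih =>
    rw [freeContraction, barD_barCone]
    · exact sub_add_cancel _ _
    intro y
    refine (map_sub _ _ _).trans (sub_eq_zero.2 ?_)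
    have h := ih (X.freeObj.barD (n + 2) y)
    rw [barD_barD, map_zero, add_zero] at h
    exact h.symm

variable {X} {Y : GammaGroup α}

/-- The contraction commutes with maps `φ` for which `foxLin` does, on the augmentation ideal. -/
lemma freeContraction_barMapLin (φ : X.freeObj.carrier → Y.freeObj.carrier)
    (hφ : ∀ y, X.freeObj.augmentation y = 0 →
      barMapLin φ _ (X.foxLin y) = Y.foxLin (Finsupp.lmapDomain ℤ ℤ φ y))
    (n : ℕ) (y : (Fin (n + 2) → X.freeObj.carrier) →₀ ℤ) :
    barMapLin φ _ (X.freeContraction n y) = Y.freeContraction n (barMapLin φ _ y) := by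
  induction n with
  | zero =>
    refine barMapLin_barCone φ (fun y => ?_) y
    refine (map_sub _ _ _).trans (congrArg (_ - ·) ?_)
    refine (hφ _ (augmentation_barToRing y)).trans (congrArg Y.foxLin ?_)
    exact (barToRing_barMapLin φ y).symm
  | succ n ih =>
    refine barMapLin_barCone φ (fun y => ?_) y
    refine (map_sub _ _ _).trans (congrArg (_ - ·) ?_)
    refine (ih _).trans (congrArg (Y.freeContraction n) ?_)
    exact (barD_barMapLin φ _ y).symm

lemma freeMap_gen (f : X ⟶ Y) (x : X.carrier) : (freeMap f).hom (X.gen x) = Y.gen (f.hom x) :=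
  FreeGroup.map.of

lemma barMapLin_barRep_inl (f : G ⟶ H) (n : ℕ) (x : G.carrier) (y : (Fin (n + 1) → G.carrier) →₀ ℤ) :
    barMapLin f.hom _ (G.barRep n (SemidirectProduct.inl x) y) =
      H.barRep n (SemidirectProduct.inl (f.hom x)) (barMapLin f.hom _ y) := by
  have : barMapLin f.hom _ ∘ₗ G.barRep n (SemidirectProduct.inl x) =
      H.barRep n (SemidirectProduct.inl (f.hom x)) ∘ₗ barMapLin f.hom _ := by
    refine Finsupp.lhom_ext' fun z => LinearMap.ext_ring ?_
    change barMapLin f.hom _ (G.barRep n (SemidirectProduct.inl x) (Finsupp.single z 1)) =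
      H.barRep n (SemidirectProduct.inl (f.hom x)) (barMapLin f.hom _ (Finsupp.single z 1))
    rw [barRep_single, barMapLin_single, barMapLin_single, barRep_single]
    simp [leftAct, Function.comp_def]
  exact LinearMap.congr_fun this y

lemma comp_gen_pair (φ : X.freeObj.carrier → Y.freeObj.carrier) (h1 : φ 1 = 1) {x : X.carrier}
    {y : Y.carrier} (h : φ (X.gen x) = Y.gen y) : φ ∘ ![1, X.gen x] = ![1, Y.gen y] := by
  funext i
  refine Fin.cases h1 (fun i => ?_) i
  rw [Subsingleton.elim i 0]
  exact h

lemma fox_freeMap (f : X ⟶ Y) (w : X.freeObj.carrier) :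
    barMapLin (freeMap f).hom _ (X.fox w) = Y.fox ((freeMap f).hom w) := by
  -- Both sides are crossed homomorphisms on `F(X)` for the bar module of `F(Y)` restricted along
  -- `F(f)`, so generators suffice.
  let r : Representation ℤ X.freeObj.carrier ((Fin 2 → Y.freeObj.carrier) →₀ ℤ) :=
    ((Y.freeObj.barRep 1).comp (SemidirectProduct.inl (φ := Y.freeObj.act))).comp (freeMap f).hom
  refine congrFun (freeObj_crossedHom_ext r
    (d := fun w => barMapLin (freeMap f).hom _ (X.fox w))
    (e := fun w => Y.fox ((freeMap f).hom w)) ?_ ?_ ?_) w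
  · intro x y
    rw [fox_mul, map_add]
    congr 1
    exact barMapLin_barRep_inl (freeMap f) 1 x _
  · intro x y
    rw [map_mul, fox_mul]
    rfl
  · intro x
    rw [fox_gen, freeMap_gen, fox_gen, barMapLin_single,
      comp_gen_pair _ (map_one _) (freeMap_gen f x)]

lemma foxLin_freeMap (f : X ⟶ Y) (y : X.freeObj.carrier →₀ ℤ) :
    barMapLin (freeMap f).hom _ (X.foxLin y) =
      Y.foxLin (Finsupp.lmapDomain ℤ ℤ (freeMap f).hom y) := by
  have : barMapLin (freeMap f).hom _ ∘ₗ X.foxLin =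
      Y.foxLin ∘ₗ Finsupp.lmapDomain ℤ ℤ (freeMap f).hom := by
    refine Finsupp.lhom_ext' fun z => LinearMap.ext_ring ?_
    change barMapLin (freeMap f).hom _ (X.foxLin (Finsupp.single z 1)) =
      Y.foxLin (Finsupp.mapDomain (freeMap f).hom (Finsupp.single z 1))
    rw [foxLin_single, Finsupp.mapDomain_single, foxLin_single, fox_freeMap]
  exact LinearMap.congr_fun this y

lemma fox_act (σ : Γ) (w : X.freeObj.carrier) :
    X.freeObj.barRep 1 (SemidirectProduct.inr σ) (X.fox w) = X.fox (X.freeObj.act σ w) := by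
  -- The action is twisted by `σ`: in the semidirect product `σ x = (σ x) σ`, where the right-hand
  -- `(σ x)` is the image of `x` under the action, so both sides become crossed homomorphisms for
  -- this twist.
  let r : Representation ℤ X.freeObj.carrier ((Fin 2 → X.freeObj.carrier) →₀ ℤ) :=
    ((X.freeObj.barRep 1).comp (SemidirectProduct.inl (φ := X.freeObj.act))).comp
      (X.freeObj.act σ).toMonoidHom
  refine congrFun (freeObj_crossedHom_ext r
    (d := fun w => X.freeObj.barRep 1 (SemidirectProduct.inr σ) (X.fox w))
    (e := fun w => X.fox (X.freeObj.act σ w)) ?_ ?_ ?_) w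
  · intro x y
    change X.freeObj.barRep 1 (SemidirectProduct.inr σ) (X.fox (x * y)) = _
    rw [fox_mul, map_add]
    congr 1
    have : SemidirectProduct.inr σ * SemidirectProduct.inl x =
        (SemidirectProduct.inl (X.freeObj.act σ x) * SemidirectProduct.inr σ : X.freeObj.sd) := by
      rw [SemidirectProduct.inl_aut, map_inv, inv_mul_cancel_right]
    have h := congrArg (X.freeObj.barRep 1) this
    rw [map_mul, map_mul] at h
    exact LinearMap.congr_fun h _
  · intro x y
    rw [map_mul]
    exact X.fox_mul _ _
  · intro x
    have h : X.freeObj.act σ (X.gen x) = X.gen (X.act σ x) := FreeGroup.map.of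
    change X.freeObj.barRep 1 (SemidirectProduct.inr σ) (X.fox (X.gen x)) =
      X.fox (X.freeObj.act σ (X.gen x))
    rw [h, fox_gen, fox_gen, barRep_single]
    congr 1
    exact comp_gen_pair (X.freeObj.leftAct (SemidirectProduct.inr σ)) (by simp [leftAct])
      (by simp [leftAct, h])

/-- The cocycle rule for `fox (g (σ z))` yields the equivariant term plus `fox g`. Summed over `y`,
the extra term is multiplied by the augmentation of `y`, which is zero. -/
lemma foxLin_groupRing (s : X.freeObj.sd) (y : X.freeObj.carrier →₀ ℤ)
    (hy : X.freeObj.augmentation y = 0) :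
    X.freeObj.barRep 1 s (X.foxLin y) = X.foxLin (X.freeObj.groupRing s y) := by
  have : X.foxLin ∘ₗ X.freeObj.groupRing s = X.freeObj.barRep 1 s ∘ₗ X.foxLin +
      LinearMap.toSpanSingleton ℤ _ (X.fox s.left) ∘ₗ X.freeObj.augmentation := by
    refine Finsupp.lhom_ext' fun z => LinearMap.ext_ring ?_
    have hs : s = SemidirectProduct.inl s.left * SemidirectProduct.inr s.right :=
      (SemidirectProduct.inl_left_mul_inr_right s).symm
    have h1 : X.freeObj.barRep 1 s (X.fox z) = X.freeObj.barRep 1 (SemidirectProduct.inl s.left)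
        (X.fox (X.freeObj.act s.right z)) := by
      rw [← fox_act]
      exact LinearMap.congr_fun ((congrArg _ hs).trans (map_mul _ _ _)) _
    change X.foxLin (X.freeObj.groupRing s (Finsupp.single z 1)) =
      X.freeObj.barRep 1 s (X.foxLin (Finsupp.single z 1)) +
        X.freeObj.augmentation (Finsupp.single z 1) • X.fox s.left
    rw [groupRing_single, foxLin_single, foxLin_single, h1, add_comm]
    simp only [augmentation, Finsupp.linearCombination_single, one_smul]
    exact X.fox_mul _ _
  have h := LinearMap.congr_fun this y
  refine Eq.trans ?_ h.symm
  change _ = _ + X.freeObj.augmentation y • X.fox s.left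
  rw [hy, zero_smul, add_zero]
  rfl

end Free

end GammaGroup

end

end EquivariantHomology

/-! ### Coefficient systems and the truncated bar complex as an acyclic model -/

namespace EquivariantHomology

open CotripleResolution

noncomputable section

lemma rep_hom_ext {k : Type*} [CommRing k] {S : Type*} [Group S] {M N : Rep.{u} k S} {f g : M ⟶ N}
    (h : ∀ x, f.hom x = g.hom x) : f = g :=
  Rep.hom_ext (Representation.IntertwiningMap.ext (LinearMap.ext h))

variable {Γ : Type u} [Group Γ] {A : Type u} [AddCommGroup A]

namespace GammaGroup

variable {α : Representation ℤ Γ A} {G H K : GammaGroup α}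

/-- The map of bar modules induced by a morphism. -/
def barMap (f : G ⟶ H) (n : ℕ) :
    Rep.of (G.barRep n) ⟶ Rep.res (sdMap f) (Rep.of (H.barRep n)) :=
  Rep.ofHom ⟨barMapLin f.hom (n + 1), fun s => by
    refine Finsupp.lhom_ext' fun z => LinearMap.ext_ring ?_
    change barMapLin f.hom _ (G.barRep n s (Finsupp.single z 1)) =
      H.barRep n (sdMap f s) (barMapLin f.hom _ (Finsupp.single z 1))
    rw [barRep_single, barMapLin_single, barMapLin_single, barRep_single]
    simp [leftAct, sdMap, Function.comp_def, f.map_act]⟩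

/-- The map of bar resolutions induced by a morphism. -/
def barHom (f : G ⟶ H) : RelResolution.Hom f G.barResolution H.barResolution where
  φ n := barMap f n
  comm i j := by
    by_cases hij : j + 1 = i
    · subst hij
      exact rep_hom_ext fun x => (H.barComplex_d j _).trans
        ((barD_barMapLin f.hom j x).trans (congrArg (barMapLin f.hom _) (G.barComplex_d j x).symm))
    · rw [G.barResolution.complex.shape i j hij, H.barResolution.complex.shape i j hij]
      exact rep_hom_ext fun x => (map_zero (barMapLin f.hom (j + 1))).symm
  comm_ε x := by
    have : (Finsupp.linearCombination ℤ fun _ => (1 : ℤ)) ∘ₗ barMapLin f.hom 1 =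
        Finsupp.linearCombination ℤ fun _ => (1 : ℤ) := by
      refine Finsupp.lhom_ext' fun z => LinearMap.ext_ring ?_
      simp
    exact congrArg ULift.up (LinearMap.congr_fun this x)

/-- The surjection of the bar complex in degree one onto the augmentation ideal. -/
def barToAug (G : GammaGroup α) : Rep.of (G.barRep 1) ⟶ G.augIdealRep :=
  Rep.ofHom ⟨G.barToRing.codRestrict G.augIdeal fun y => augmentation_barToRing y, fun s => by
    apply LinearMap.ext
    intro y
    exact Subtype.ext (barToRing_barMapLin (G.leftAct s) y)⟩

/-- The section of `barToAug` for a free object. -/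
def augToBar (X : GammaGroup α) : X.freeObj.augIdealRep ⟶ Rep.of (X.freeObj.barRep 1) :=
  Rep.ofHom ⟨X.foxLin ∘ₗ X.freeObj.augIdeal.subtype, fun s => by
    apply LinearMap.ext
    intro y
    exact (foxLin_groupRing s y.1 y.2).symm⟩

/-- The equivariant contraction of the bar complex of a free object. -/
def freeBarContraction (X : GammaGroup α) (n : ℕ) :
    Rep.of (X.freeObj.barRep (n + 1)) ⟶ Rep.of (X.freeObj.barRep (n + 2)) :=
  Rep.ofHom ⟨X.freeContraction n, fun s => by
    apply LinearMap.ext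
    intro y
    -- The left action of `s` is treated as a mere map of sets; equivariance of `foxLin` on the
    -- augmentation ideal is all that is needed.
    exact (freeContraction_barMapLin (X.freeObj.leftAct s)
      (fun y hy => foxLin_groupRing s y hy) n y).symm⟩

/-- The differential of the bar complex. -/
def barDiff (G : GammaGroup α) (n : ℕ) : Rep.of (G.barRep (n + 1)) ⟶ Rep.of (G.barRep n) :=
  G.barComplex.d (n + 1) n

lemma barDiff_barToAug : G.barDiff 1 ≫ G.barToAug = 0 :=
  rep_hom_ext fun y => Subtype.ext
    ((congrArg G.barToRing (G.barComplex_d 1 y)).trans (barToRing_barD y))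

lemma barMap_barToAug (f : G ⟶ H) :
    barMap f 1 ≫ Rep.resMap (sdMap f) H.barToAug = G.barToAug ≫ augIdealMap f :=
  rep_hom_ext fun y => Subtype.ext (barToRing_barMapLin f.hom y)

lemma augIdealMap_augToBar (f : G ⟶ H) :
    augIdealMap (freeMap f) ≫ Rep.resMap (sdMap (freeMap f)) H.augToBar =
      G.augToBar ≫ barMap (freeMap f) 1 :=
  rep_hom_ext fun y => (foxLin_freeMap f y.1).symm

lemma barMap_freeBarContraction (f : G ⟶ H) (n : ℕ) :
    barMap (freeMap f) (n + 1) ≫ Rep.resMap (sdMap (freeMap f)) (H.freeBarContraction n) =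
      G.freeBarContraction n ≫ barMap (freeMap f) (n + 2) :=
  rep_hom_ext fun y => (freeContraction_barMapLin (freeMap f).hom
      (fun y _ => foxLin_freeMap f y) n y).symm

lemma augToBar_barToAug (X : GammaGroup α) : X.augToBar ≫ X.freeObj.barToAug = 𝟙 _ :=
  rep_hom_ext fun y => Subtype.ext (X.barToRing_foxLin y.2)

lemma freeBarContraction_zero (X : GammaGroup α) :
    X.freeBarContraction 0 ≫ X.freeObj.barDiff 1 + X.freeObj.barToAug ≫ X.augToBar = 𝟙 _ :=
  rep_hom_ext fun y => Eq.trans (congrArg (· + X.foxLin (X.freeObj.barToRing y))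
    (X.freeObj.barComplex_d 1 (X.freeContraction 0 y))) (X.barD_freeContraction_zero y)

lemma freeBarContraction_succ (X : GammaGroup α) (n : ℕ) :
    X.freeBarContraction (n + 1) ≫ X.freeObj.barDiff (n + 2) +
      X.freeObj.barDiff (n + 1) ≫ X.freeBarContraction n = 𝟙 _ :=
  rep_hom_ext fun y => Eq.trans (congrArg₂ (fun a b => a + X.freeContraction n b)
    (X.freeObj.barComplex_d (n + 2) (X.freeContraction (n + 1) y))
    (X.freeObj.barComplex_d (n + 1) y)) (X.barD_freeContraction_succ n y)

end GammaGroup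

open GammaGroup

/-- A system of coefficients: additive functors on the categories of `G ⋊ Γ`-modules, covariant with
respect to maps which are equivariant along a morphism `G ⟶ H`, whose values on the bar modules
`ℤ(G ^ (n + 1))` naturally are retracts of those for the free object `F(G)`. -/
structure CoefficientSystem (α : Representation ℤ Γ A) (D : Type*) [Category* D]
    [Preadditive D] where
  /-- the functors -/
  F : ∀ G : GammaGroup α, Rep.{u} ℤ G.sd ⥤ D
  additive : ∀ G, (F G).Additive
  /-- the map induced by an equivariant map along `f` -/
  map : ∀ {G H : GammaGroup α} (f : G ⟶ H) {M : Rep.{u} ℤ G.sd} {N : Rep.{u} ℤ H.sd}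
    (_ : M ⟶ Rep.res (sdMap f) N), (F G).obj M ⟶ (F H).obj N
  comp_map : ∀ {G H : GammaGroup α} (f : G ⟶ H) {L M : Rep.{u} ℤ G.sd} {N : Rep.{u} ℤ H.sd}
    (k : L ⟶ M) (g : M ⟶ Rep.res (sdMap f) N), (F G).map k ≫ map f g = map f (k ≫ g)
  map_comp : ∀ {G H : GammaGroup α} (f : G ⟶ H) {M : Rep.{u} ℤ G.sd} {N L : Rep.{u} ℤ H.sd}
    (g : M ⟶ Rep.res (sdMap f) N) (k : N ⟶ L),
    map f g ≫ (F H).map k = map f (g ≫ Rep.resMap (sdMap f) k)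
  -- Identity and composition laws are stated for any map with the right values, which avoids
  -- identifying the restrictions along `sdMap (𝟙 G)` and along composites.
  map_id : ∀ {G : GammaGroup α} {M : Rep.{u} ℤ G.sd} (g : M ⟶ Rep.res (sdMap (𝟙 G)) M),
    (∀ x, g.hom x = x) → map (𝟙 G) g = 𝟙 _
  map_map : ∀ {G H K : GammaGroup α} (f : G ⟶ H) (f' : H ⟶ K) {M : Rep.{u} ℤ G.sd}
    {N : Rep.{u} ℤ H.sd} {L : Rep.{u} ℤ K.sd} (g : M ⟶ Rep.res (sdMap f) N)
    (g' : N ⟶ Rep.res (sdMap f') L) (g'' : M ⟶ Rep.res (sdMap (f ≫ f')) L),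
    (∀ x, g''.hom x = g'.hom (g.hom x)) → map f g ≫ map f' g' = map (f ≫ f') g''
  /-- the section of `F (ℤ(F(G) ^ (n + 1))) ⟶ F (ℤ(G ^ (n + 1)))` -/
  barSection : ∀ (n : ℕ) (G : GammaGroup α),
    (F G).obj (Rep.of (G.barRep n)) ⟶ (F G.freeObj).obj (Rep.of (G.freeObj.barRep n))
  barSection_natural : ∀ (n : ℕ) {G H : GammaGroup α} (f : G ⟶ H),
    map f (barMap f n) ≫ barSection n H = barSection n G ≫ map (freeMap f) (barMap (freeMap f) n)
  barSection_counit : ∀ (n : ℕ) (G : GammaGroup α),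
    barSection n G ≫ map ((freeCotriple α).ε.app G) (barMap ((freeCotriple α).ε.app G) n) = 𝟙 _

namespace CoefficientSystem

attribute [instance] CoefficientSystem.additive

variable {α : Representation ℤ Γ A} {D : Type*} [Category* D]

section

variable [Preadditive D] (S : CoefficientSystem α D) {G H K : GammaGroup α}

/-- The complex computing the homology of `G` with coefficients in `S`, for a resolution. -/
abbrev complex (P : RelResolution G) : ChainComplex D ℕ :=
  ((S.F G).mapHomologicalComplex _).obj P.complex

/-- The chain map induced by a map of resolutions. -/
def chainMap {f : G ⟶ H} {P : RelResolution G} {Q : RelResolution H} (φ : RelResolution.Hom f P Q) :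
    S.complex P ⟶ S.complex Q where
  f n := S.map f (φ.φ n)
  comm' i j _ := (S.map_comp f _ _).trans
    ((congrArg (S.map f) (φ.comm i j)).trans (S.comp_map f _ _).symm)

/-- The functor `G ↦ S (I(G))`. -/
def augFunctor : GammaGroup α ⥤ D where
  obj G := (S.F G).obj G.augIdealRep
  map f := S.map f (augIdealMap f)
  map_id G := S.map_id _ fun (_ : G.augIdeal) => Subtype.ext Finsupp.mapDomain_id
  map_comp f g := (S.map_map f g _ _ _ fun (x : GammaGroup.augIdeal _) => Subtype.ext
    (Finsupp.mapDomain_comp (f := f.hom) (g := g.hom) (v := x.1))).symm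

/-- The functor taking `G` to its bar complex with coefficients in `S`. -/
def barFunctor : GammaGroup α ⥤ ChainComplex D ℕ where
  obj G := S.complex G.barResolution
  map f := S.chainMap (barHom f)
  map_id G := by
    ext n
    exact S.map_id _ fun _ => Finsupp.mapDomain_id
  map_comp f g := by
    ext n
    exact (S.map_map f g _ _ _ fun x =>
      Finsupp.mapDomain_comp (f := fun x => f.hom ∘ x) (g := fun x => g.hom ∘ x) (v := x)).symm

lemma map_contraction {C : Type*} [Category* C] [Preadditive C] (F : C ⥤ D) [F.Additive]
    {X Y Z : C} {a : X ⟶ Y} {b : Y ⟶ X} {c : X ⟶ Z} {d : Z ⟶ X} (h : a ≫ b + c ≫ d = 𝟙 X) :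
    F.map a ≫ F.map b + F.map c ≫ F.map d = 𝟙 _ := by
  rw [← F.map_comp, ← F.map_comp, ← F.map_add, h, F.map_id]

/-- The truncated bar complex is an acyclic model. -/
def barAcyclicModel :
    AcyclicModel (freeCotriple α) S.augFunctor (S.barFunctor ⋙ ChainComplex.truncate) where
  ε X := (S.F X).map X.barToAug
  ε_natural f := (S.map_comp f _ _).trans
    (Eq.trans (congrArg (S.map f) (barMap_barToAug f)) (S.comp_map f _ _).symm)
  d_ε X := ((S.F X).map_comp (X.barDiff 1) X.barToAug).symm.trans
    ((congrArg (S.F X).map barDiff_barToAug).trans ((S.F X).map_zero _ _))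
  -- Truncation puts the bar module of index `n + 1` in degree `n`.
  θ n X := S.barSection (n + 1) X
  θ_natural n _ _ f := S.barSection_natural (n + 1) f
  θ_ε n X := S.barSection_counit (n + 1) X
  sε X := (S.F X.freeObj).map X.augToBar
  sε_natural f := (S.map_comp (freeMap f) _ _).trans
    (Eq.trans (congrArg (S.map (freeMap f)) (augIdealMap_augToBar f))
      (S.comp_map (freeMap f) _ _).symm)
  s n X := (S.F X.freeObj).map (X.freeBarContraction n)
  s_natural n _ _ f := (S.map_comp (freeMap f) _ _).trans
    (Eq.trans (congrArg (S.map (freeMap f)) (barMap_freeBarContraction f n))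
      (S.comp_map (freeMap f) _ _).symm)
  sε_ε X := ((S.F X.freeObj).map_comp _ _).symm.trans
    ((congrArg (S.F X.freeObj).map X.augToBar_barToAug).trans ((S.F X.freeObj).map_id _))
  s_zero X := map_contraction (S.F X.freeObj) X.freeBarContraction_zero
  s_succ n X := map_contraction (S.F X.freeObj) (X.freeBarContraction_succ n)

end

end CoefficientSystem

end

end EquivariantHomology

/-! ### Relative projectivity and comparison of resolutions -/

namespace EquivariantHomology

open CotripleResolution

noncomputable section

variable {Γ : Type u} [Group Γ] {A : Type u} [AddCommGroup A]

namespace GammaGroup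

variable {α : Representation ℤ Γ A} {G H K : GammaGroup α}

/-- The homomorphism `sdMap f` is the identity on `Γ`, so the same section remains a `Γ`-map after
restriction. -/
lemma IsGammaSplitOver.resMap {M N : Rep.{u} ℤ H.sd} {p : M ⟶ N} {K : Set N.V}
    (hp : IsGammaSplitOver p K) (f : G ⟶ H) :
    IsGammaSplitOver (G := G) (Rep.resMap (sdMap f) p) K := by
  obtain ⟨γ, hγ⟩ := hp
  refine ⟨γ, fun x hx => ⟨(hγ x hx).1, fun σ => ?_⟩⟩
  have h : sdMap f (SemidirectProduct.inr σ) = SemidirectProduct.inr σ := by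
    simp [sdMap]
  change γ (N.ρ (sdMap f (SemidirectProduct.inr σ)) x) =
    M.ρ (sdMap f (SemidirectProduct.inr σ)) (γ x)
  rw [h]
  exact (hγ x hx).2 σ

/-- Maps from a relatively free module lift along `Γ`-split epimorphisms. -/
lemma IsRelFree.exists_lift {F N N' : Rep.{u} ℤ G.sd} (hF : IsRelFree F) {p : N ⟶ N'}
    {K : Set N'.V} (hp : IsGammaSplitOver p K) (g : F ⟶ N') (hg : ∀ x, g.hom x ∈ K) :
    ∃ h : F ⟶ N, h ≫ p = g := by
  obtain ⟨γ, hγ⟩ := hp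
  obtain ⟨s, hs, hli, hsp⟩ := hF
  let _ := F.hV2
  let _ := N.hV2
  let _ := N'.hV2
  have e : AddCommGroup.toIntModule F.V = F.hV2 := Subsingleton.elim _ _
  rw [e] at hli hsp
  let b : Module.Basis (G.carrier × s) ℤ F.V := Module.Basis.mk hli hsp.ge
  have hb (q : G.carrier × s) : b q = F.ρ (SemidirectProduct.inl q.1) q.2.1 :=
    Module.Basis.mk_apply hli hsp.ge q
  -- On the `ℤ`-basis of translates `g x` the lift is forced by `G`-linearity once `x` is sent to
  -- the chosen preimage of its image. Compatibility with `Γ` then uses that `s` is a `Γ`-subset and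
  -- that `γ` is a `Γ`-map on `K`.
  let h : F.V →ₗ[ℤ] N.V :=
    b.constr ℕ fun q => N.ρ (SemidirectProduct.inl q.1) (γ (g.hom q.2.1))
  have hh (q : G.carrier × s) : h (b q) = N.ρ (SemidirectProduct.inl q.1) (γ (g.hom q.2.1)) :=
    b.constr_basis ℕ _ q
  have heq (t : G.sd) : h ∘ₗ F.ρ t = N.ρ t ∘ₗ h := by
    refine b.ext fun q => ?_
    have ht : t * SemidirectProduct.inl q.1 =
        SemidirectProduct.inl (t.left * G.act t.right q.1) * SemidirectProduct.inr t.right := by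
      ext <;> simp
    have h1 : F.ρ t (b q) = b (t.left * G.act t.right q.1, ⟨_, hs t.right _ q.2.2⟩) := by
      rw [hb, hb, ← Module.End.mul_apply, ← map_mul, ht, map_mul]
      rfl
    have h2 : N.ρ (SemidirectProduct.inl (t.left * G.act t.right q.1)) *
        N.ρ (SemidirectProduct.inr t.right) = N.ρ t * N.ρ (SemidirectProduct.inl q.1) := by
      rw [← map_mul, ← map_mul, ht]
    have h3 : γ (g.hom (F.ρ (SemidirectProduct.inr t.right) q.2.1)) =
        N.ρ (SemidirectProduct.inr t.right) (γ (g.hom q.2.1)) := by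
      rw [← (hγ _ (hg _)).2, ← Rep.hom_comm_apply]
    rw [LinearMap.comp_apply, LinearMap.comp_apply, h1, hh, hh, h3]
    exact LinearMap.congr_fun h2 (γ (g.hom q.2.1))
  refine ⟨Rep.ofHom ⟨h, heq⟩, Rep.hom_ext (Representation.IntertwiningMap.ext (b.ext fun q => ?_))⟩
  change p.hom (h (b q)) = g.hom (b q)
  rw [hh, hb, Rep.hom_comm_apply, (hγ _ (hg _)).1, Rep.hom_comm_apply]

/-- Maps from a relatively projective module lift along `Γ`-split epimorphisms. -/
lemma IsRelProjective.exists_lift {M N N' : Rep.{u} ℤ G.sd} (hM : IsRelProjective M) {p : N ⟶ N'}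
    {K : Set N'.V} (hp : IsGammaSplitOver p K) (g : M ⟶ N') (hg : ∀ x, g.hom x ∈ K) :
    ∃ h : M ⟶ N, h ≫ p = g := by
  obtain ⟨F, hF, ⟨r⟩⟩ := hM
  obtain ⟨h, hh⟩ := hF.exists_lift hp (r.r ≫ g) fun x => hg _
  exact ⟨r.i ≫ h, by rw [Category.assoc, hh, r.retract_assoc]⟩

lemma IsRelProjective.liftsCycles {M : Rep.{u} ℤ G.sd} (hM : IsRelProjective M)
    {C : ChainComplex (Rep.{u} ℤ G.sd) ℕ} {N : Rep.{u} ℤ G.sd} {ε : C.X 0 ⟶ N}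
    (hε : IsGammaSplitOver ε Set.univ) (h0 : IsGammaSplitOver (C.d 1 0) {x | ε.hom x = 0})
    (hs : ∀ n, IsGammaSplitOver (C.d (n + 2) (n + 1)) {x | (C.d (n + 1) n).hom x = 0}) :
    LiftsCycles M C ε where
  lift_ε g := hM.exists_lift hε g fun _ => trivial
  lift_zero g hg := hM.exists_lift h0 g fun x => congrArg (fun f : M ⟶ N => f.hom x) hg
  lift_succ n g hg := hM.exists_lift (hs n) g fun x =>
    congrArg (fun f : M ⟶ C.X n => f.hom x) hg

namespace RelResolution

lemma liftsCycles (P Q : RelResolution G) (n : ℕ) : LiftsCycles (P.complex.X n) Q.complex Q.ε :=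
  (P.projective n).liftsCycles Q.split_ε Q.split_zero Q.split_succ

/-- The restriction of the complex of a resolution along a morphism. -/
abbrev resComplex (f : G ⟶ H) (Q : RelResolution H) : ChainComplex (Rep.{u} ℤ G.sd) ℕ :=
  ((Rep.resFunctor (sdMap f)).mapHomologicalComplex _).obj Q.complex

/-- Only the source need be relatively projective. The restriction of `Q` need not be, but it is
still `Γ`-split exact, so maps along `f` can be compared inside modules over `G ⋊ Γ`. -/
lemma liftsCycles_res (f : G ⟶ H) (P : RelResolution G) (Q : RelResolution H) (n : ℕ) :
    LiftsCycles (P.complex.X n) (Q.resComplex f) (Rep.resMap (sdMap f) Q.ε) :=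
  (P.projective n).liftsCycles (Q.split_ε.resMap f) (Q.split_zero.resMap f)
    fun n => (Q.split_succ n).resMap f

/-- A map of resolutions as a chain map. -/
def Hom.toChainMap {f : G ⟶ H} {P : RelResolution G} {Q : RelResolution H} (φ : Hom f P Q) :
    P.complex ⟶ Q.resComplex f where
  f := φ.φ
  comm' i j _ := φ.comm i j

lemma exists_homotopyEquiv (P Q : RelResolution G) :
    ∃ e : HomotopyEquiv P.complex Q.complex, e.hom.f 0 ≫ Q.ε = P.ε :=
  LiftsCycles.exists_homotopyEquiv (P.liftsCycles Q) (Q.liftsCycles P) (P.liftsCycles P)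
    (Q.liftsCycles Q) P.d_ε Q.d_ε

/-- Any two relatively projective resolutions are homotopy equivalent. -/
def homotopyEquiv (P Q : RelResolution G) : HomotopyEquiv P.complex Q.complex :=
  (P.exists_homotopyEquiv Q).choose

lemma homotopyEquiv_ε (P Q : RelResolution G) : (P.homotopyEquiv Q).hom.f 0 ≫ Q.ε = P.ε :=
  (P.exists_homotopyEquiv Q).choose_spec

/-- The homotopy equivalences between resolutions are natural up to homotopy. -/
lemma homotopyEquiv_natural {f : G ⟶ H} {P P' : RelResolution G} {Q Q' : RelResolution H}
    (φ : Hom f P Q) (φ' : Hom f P' Q') :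
    Nonempty (Homotopy ((P.homotopyEquiv P').hom ≫ φ'.toChainMap)
      (φ.toChainMap ≫ ((Rep.resFunctor (sdMap f)).mapHomologicalComplex _).map
        (Q.homotopyEquiv Q').hom)) := by
  -- Both composites lie over the identity of `ℤ`, so uniqueness of lifts up to homotopy applies.
  refine LiftsCycles.homotopy (liftsCycles_res f P Q') _ _ (rep_hom_ext fun x => ?_)
  have h1 := congrArg (fun g : P.complex.X 0 ⟶ G.trivialInt => g.hom x) (P.homotopyEquiv_ε P')
  have h2 := congrArg (fun g : Q.complex.X 0 ⟶ H.trivialInt => g.hom ((φ.φ 0).hom x))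
    (Q.homotopyEquiv_ε Q')
  exact ((φ'.comm_ε _).trans h1).trans ((φ.comm_ε x).symm.trans h2.symm)

end RelResolution

end GammaGroup

/-! ### Homology with coefficients as a cotriple derived functor -/

open GammaGroup

/-- The homology of the truncation of a chain complex, in positive degrees. -/
def truncateHomologyIso (D : Type*) [Category* D] [Abelian D] (m : ℕ) :
    HomologicalComplex.homologyFunctor D (ComplexShape.down ℕ) (m + 2) ≅
      ChainComplex.truncate ⋙ HomologicalComplex.homologyFunctor D _ (m + 1) :=
  -- Degree `m + 1` of the truncation is positive, so both adjacent differentials are those of the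
  -- original complex; in degree `0` the outgoing one would be lost.
  HomologicalComplex.homologyFunctorIso' D _ (m + 3) (m + 2) (m + 1) (by simp) (by simp) ≪≫
    (Functor.isoWhiskerLeft ChainComplex.truncate (HomologicalComplex.homologyFunctorIso' D
      (ComplexShape.down ℕ) (m + 2) (m + 1) m (by simp) (by simp))).symm

namespace CoefficientSystem

variable {α : Representation ℤ Γ A} {D : Type*} [Category* D]

section

variable [Preadditive D] (S : CoefficientSystem α D) {G H : GammaGroup α}

/-- The coefficients of the restriction of a module. -/
def resNat (f : G ⟶ H) : Rep.resFunctor (sdMap f) ⋙ S.F G ⟶ S.F H where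
  app N := S.map f (𝟙 (Rep.res (sdMap f) N))
  naturality _ _ k := (S.comp_map f _ _).trans (Eq.trans (congrArg (S.map f)
    (rep_hom_ext fun _ => rfl)) (S.map_comp f (𝟙 _) k).symm)

/-- Separates a chain map of modules over `G ⋊ Γ`, to which homotopies apply, from the change of
group, which is natural in the module. -/
lemma chainMap_eq {f : G ⟶ H} {P : RelResolution G} {Q : RelResolution H}
    (φ : RelResolution.Hom f P Q) : S.chainMap φ =
      ((S.F G).mapHomologicalComplex _).map φ.toChainMap ≫
        (NatTrans.mapHomologicalComplex (S.resNat f) _).app Q.complex := by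
  ext n
  exact (congrArg (S.map f) (rep_hom_ext fun _ => rfl)).trans
    (S.comp_map f (φ.φ n) (𝟙 (Rep.res (sdMap f) (Q.complex.X n)))).symm

end

variable [Abelian D] (S : CoefficientSystem α D) {G H : GammaGroup α}

/-- The homology computed by two resolutions. -/
def homologyIso (P Q : RelResolution G) (n : ℕ) :
    (S.complex P).homology n ≅ (S.complex Q).homology n :=
  ((S.F G).mapHomotopyEquiv (P.homotopyEquiv Q)).toHomologyIso n

/-- Apply `S.F G` to the homotopy of `homotopyEquiv_natural` and compose with the change of group;
`h1` and `h2` bring the two composites into this form. -/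
lemma homologyIso_natural {f : G ⟶ H} {P P' : RelResolution G} {Q Q' : RelResolution H}
    (φ : RelResolution.Hom f P Q) (φ' : RelResolution.Hom f P' Q') (n : ℕ) :
    (S.homologyIso P P' n).hom ≫ HomologicalComplex.homologyMap (S.chainMap φ') n =
      HomologicalComplex.homologyMap (S.chainMap φ) n ≫ (S.homologyIso Q Q' n).hom := by
  obtain ⟨h⟩ := RelResolution.homotopyEquiv_natural φ φ'
  have k := ((S.F G).mapHomotopy h).compRight
    ((NatTrans.mapHomologicalComplex (S.resNat f) _).app Q'.complex)
  have h1 : ((S.F G).mapHomologicalComplex _).map (P.homotopyEquiv P').hom ≫ S.chainMap φ' =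
      ((S.F G).mapHomologicalComplex _).map ((P.homotopyEquiv P').hom ≫ φ'.toChainMap) ≫
        (NatTrans.mapHomologicalComplex (S.resNat f) _).app Q'.complex := by
    rw [chainMap_eq, Functor.map_comp]
    exact (Category.assoc _ _ _).symm
  have h2 : S.chainMap φ ≫ ((S.F H).mapHomologicalComplex _).map (Q.homotopyEquiv Q').hom =
      ((S.F G).mapHomologicalComplex _).map (φ.toChainMap ≫
        ((Rep.resFunctor (sdMap f)).mapHomologicalComplex _).map (Q.homotopyEquiv Q').hom) ≫
        (NatTrans.mapHomologicalComplex (S.resNat f) _).app Q'.complex := by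
    rw [chainMap_eq, Functor.map_comp]
    refine (Category.assoc _ _ _).trans (Eq.trans (congrArg _ ?_) (Category.assoc _ _ _).symm)
    exact ((NatTrans.mapHomologicalComplex (S.resNat f) _).naturality
      (Q.homotopyEquiv Q').hom).symm
  refine (HomologicalComplex.homologyMap_comp _ _ n).symm.trans
    (Eq.trans ?_ (HomologicalComplex.homologyMap_comp _ _ n))
  exact (congrArg (HomologicalComplex.homologyMap · n) h1).trans
    ((k.homologyMap_eq n).trans (congrArg (HomologicalComplex.homologyMap · n) h2).symm)

/-- The homology with coefficients in `S` in degrees `≥ 2` as cotriple derived functors. -/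
theorem exists_leftDerivedIso (m : ℕ) :
    ∃ e : ∀ (G : GammaGroup α) (P : RelResolution G), (S.complex P).homology (m + 2) ≅
        (leftDerived (freeCotriple α) S.augFunctor (m + 1)).obj G,
      ∀ (G H : GammaGroup α) (f : G ⟶ H) (P : RelResolution G) (Q : RelResolution H)
        (φ : RelResolution.Hom f P Q),
        (e G P).hom ≫ (leftDerived (freeCotriple α) S.augFunctor (m + 1)).map f =
          HomologicalComplex.homologyMap (S.chainMap φ) (m + 2) ≫ (e H Q).hom := by
  -- Both models are augmented to the functor `G ↦ S(I(G))`.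
  obtain ⟨h⟩ := S.barAcyclicModel.exists_homotopyEquiv
    (cotripleAcyclicModel (freeCotriple α) S.augFunctor)
  let i : S.barFunctor ⋙ HomologicalComplex.homologyFunctor D _ (m + 2) ≅
      leftDerived (freeCotriple α) S.augFunctor (m + 1) :=
    Functor.isoWhiskerLeft S.barFunctor (truncateHomologyIso D m) ≪≫
      CotripleResolution.homologyIso h (m + 1)
  refine ⟨fun G P => S.homologyIso P G.barResolution (m + 2) ≪≫ i.app G, fun G H f P Q φ => ?_⟩
  have h1 := S.homologyIso_natural φ (barHom f) (m + 2)
  have h2 := i.hom.naturality f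
  refine (Category.assoc _ _ _).trans ((congrArg _ h2.symm).trans ?_)
  refine (Category.assoc _ _ _).symm.trans ?_
  exact (congrArg (· ≫ i.hom.app H) h1).trans (Category.assoc _ _ _)

end CoefficientSystem

end

end EquivariantHomology

/-! ### The two coefficient systems and their sections on bar modules -/

namespace EquivariantHomology

open CotripleResolution

noncomputable section

variable {Γ : Type u} [Group Γ] {A : Type u} [AddCommGroup A]

namespace GammaGroup

variable {α : Representation ℤ Γ A} {G H K : GammaGroup α}

/-- The tuple `(|x_0⁻¹ x_i|)_i` of generators of `F(G)`. -/
def freeTuple {n : ℕ} (x : Fin (n + 1) → G.carrier) (i : Fin (n + 1)) : G.freeObj.carrier :=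
  G.gen ((x 0)⁻¹ * x i)

lemma counit_freeTuple {n : ℕ} (x : Fin (n + 1) → G.carrier) :
    ((freeCotriple α).ε.app G).hom ∘ freeTuple x =
      fun i => G.leftAct (SemidirectProduct.inl (x 0)⁻¹) (x i) := by
  funext i
  refine (FreeGroup.lift_apply_of (f := id)).trans ?_
  simp [leftAct]

lemma freeMap_freeTuple (f : G ⟶ H) {n : ℕ} (x : Fin (n + 1) → G.carrier) :
    (freeMap f).hom ∘ freeTuple x = freeTuple (f.hom ∘ x) := by
  funext i
  refine (freeMap_gen f _).trans ?_
  simp [freeTuple]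

/-- Translation by the `G`-component of `s` cancels in `x_0⁻¹ x_i`. Only `Γ` remains, and it acts on
generators; thus the tuple is defined up to an action visible in `F(G) ⋊ Γ`. -/
lemma freeTuple_leftAct (s : G.sd) {n : ℕ} (x : Fin (n + 1) → G.carrier) :
    freeTuple (fun i => G.leftAct s (x i)) =
      fun i => G.freeObj.leftAct (SemidirectProduct.inr s.right) (freeTuple x i) := by
  funext i
  have h (y : G.carrier) : G.freeObj.act s.right (G.gen y) = G.gen (G.act s.right y) :=
    FreeGroup.map.of
  simp only [freeTuple, leftAct, SemidirectProduct.left_inr, SemidirectProduct.right_inr, h, one_mul]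
  congr 1
  simp [mul_assoc]

lemma coeffRep_inl (g : G.carrier) (a : A) : G.coeffRep (SemidirectProduct.inl g) a = G.ρ g a := by
  simp [coeffRep]

lemma coeffRep_inr (σ : Γ) (a : A) : G.coeffRep (SemidirectProduct.inr σ) a = α σ a := by
  simp [coeffRep]

lemma coeffRep_apply (s : G.sd) (a : A) : G.coeffRep s a = G.ρ s.left (α s.right a) := rfl

lemma ρ_leftAct (s : G.sd) (x : G.carrier) (a : A) :
    G.ρ (G.leftAct s x) (α s.right a) = G.coeffRep s (G.ρ x a) := by
  rw [coeffRep_apply, G.compat, leftAct, map_mul]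
  rfl

/-- The same cancellation on the coefficient side: after multiplication by `x_0⁻¹`, only `Γ` acts.
-/
lemma ρ_inv_leftAct (s : G.sd) (x : G.carrier) (a : A) :
    G.ρ (G.leftAct s x)⁻¹ (G.coeffRep s a) = α s.right (G.ρ x⁻¹ a) := by
  have h := G.ρ_leftAct s x (G.ρ x⁻¹ a)
  rw [Representation.self_inv_apply] at h
  rw [← h, Representation.inv_self_apply]

end GammaGroup

open GammaGroup

section TensorCoefficients

variable {α : Representation ℤ Γ A} {G H K : GammaGroup α}

lemma tensorOver_finsupp_ext {k : Type} [CommRing k] {S : Type*} [Group S] {X : Type u}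
    {ρ : Representation k S (X →₀ k)} {B : Rep.{u} k S} {N : ModuleCat.{u} k}
    {p q : tensorOver (Rep.of ρ) B ⟶ N}
    (h : ∀ (x : X) b, p.hom (tmk (M := Rep.of ρ) (Finsupp.single x 1) b) =
      q.hom (tmk (M := Rep.of ρ) (Finsupp.single x 1) b)) : p = q := by
  apply ModuleCat.hom_ext
  apply Representation.Coinvariants.hom_ext
  apply TensorProduct.ext
  exact Finsupp.lhom_ext' fun x => LinearMap.ext_ring (LinearMap.ext fun b => h x b)

lemma tmk_smul_smul {k : Type*} [CommRing k] {S : Type*} [Group S] {M B : Rep.{u} k S} (s : S) (x : M.V)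
    (b : B.V) : tmk (M := M) (B := B) (M.ρ s x) (B.ρ s b) = tmk x b :=
  Representation.Coinvariants.mk_self_apply (M.ρ.tprod B.ρ) s (x ⊗ₜ[k] b)

lemma barTensor_ext {n : ℕ} {B : Rep.{u} ℤ G.sd} {N : ModuleCat.{u} ℤ}
    {p q : tensorOver (Rep.of (G.barRep n)) B ⟶ N}
    (h : ∀ (x : Fin (n + 1) → G.carrier) b,
      p.hom (tmk (M := Rep.of (G.barRep n)) (Finsupp.single x 1) b) =
        q.hom (tmk (M := Rep.of (G.barRep n)) (Finsupp.single x 1) b)) : p = q :=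
  tensorOver_finsupp_ext h

/-- The bilinear map defining `tensorBarSection`. -/
def tensorBarSectionAux (n : ℕ) (G : GammaGroup α) : ((Fin (n + 1) → G.carrier) →₀ ℤ) →ₗ[ℤ] A →ₗ[ℤ]
    (G.freeObj.barRep n |>.tprod G.freeObj.coeffRep).Coinvariants :=
  Finsupp.linearCombination ℤ fun x =>
    (Representation.Coinvariants.mk (G.freeObj.barRep n |>.tprod G.freeObj.coeffRep)) ∘ₗ
      TensorProduct.mk ℤ _ A (Finsupp.single (freeTuple x) 1) ∘ₗ G.ρ (x 0)⁻¹

lemma tensorBarSectionAux_single (n : ℕ) (x : Fin (n + 1) → G.carrier) (a : A) :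
    tensorBarSectionAux n G (Finsupp.single x 1) a = tmk (M := Rep.of (G.freeObj.barRep n))
      (B := G.freeObj.coeff) (Finsupp.single (freeTuple x) 1) (G.ρ (x 0)⁻¹ a) := by
  rw [tensorBarSectionAux, Finsupp.linearCombination_single, one_smul]
  rfl

/-- The map `x ⊗ a ↦ (|x_0⁻¹ x_i|)_i ⊗ x_0⁻¹ a`. -/
def tensorBarSection (n : ℕ) (G : GammaGroup α) : tensorOver (Rep.of (G.barRep n)) G.coeff ⟶
    tensorOver (Rep.of (G.freeObj.barRep n)) G.freeObj.coeff :=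
  ModuleCat.ofHom (Representation.Coinvariants.lift _
    (TensorProduct.lift (tensorBarSectionAux n G)) fun s => by
      apply TensorProduct.ext
      refine Finsupp.lhom_ext' fun x => LinearMap.ext_ring (LinearMap.ext fun a => ?_)
      change tensorBarSectionAux n G (G.barRep n s (Finsupp.single x 1)) (G.coeffRep s a) =
        tensorBarSectionAux n G (Finsupp.single x 1) a
      rw [barRep_single, tensorBarSectionAux_single, tensorBarSectionAux_single, ρ_inv_leftAct,
        freeTuple_leftAct]
      -- Both tensor factors are now moved by the same `σ`, which is invisible in the coinvariants.
      refine Eq.trans ?_ (tmk_smul_smul (M := Rep.of (G.freeObj.barRep n))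
        (B := G.freeObj.coeff) (SemidirectProduct.inr s.right) _ _)
      exact congrArg₂ (fun y b => tmk (M := Rep.of (G.freeObj.barRep n)) (B := G.freeObj.coeff) y b)
        (barRep_single n _ _ _).symm (coeffRep_inr (G := G.freeObj) _ _).symm)

lemma tensorBarSection_single (n : ℕ) (x : Fin (n + 1) → G.carrier) (a : A) :
    (tensorBarSection n G).hom (tmk (M := Rep.of (G.barRep n)) (B := G.coeff) (Finsupp.single x 1) a) =
      tmk (M := Rep.of (G.freeObj.barRep n))
        (B := G.freeObj.coeff) (Finsupp.single (freeTuple x) 1) (G.ρ (x 0)⁻¹ a) :=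
  tensorBarSectionAux_single n x a

lemma barMap_single (f : G ⟶ H) (n : ℕ) (x : Fin (n + 1) → G.carrier) :
    (barMap f n).hom (Finsupp.single x 1) = Finsupp.single (f.hom ∘ x) (1 : ℤ) :=
  barMapLin_single _ _ _ _

/-- The coefficient system `M ↦ M ⊗_{G ⋊ Γ} A`. -/
def tensorCoefficients (α : Representation ℤ Γ A) : CoefficientSystem α (ModuleCat.{u} ℤ) where
  F G := tensorFunctor G.coeff
  additive _ := inferInstance
  map f _ _ g := tensorOverMap (sdMap f) g (coeffToRes f)
  comp_map _ _ _ _ _ _ := tensorOver_ext fun _ _ => rfl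
  map_comp _ _ _ _ _ _ := tensorOver_ext fun _ _ => rfl
  map_id {G M} _ h := tensorOver_ext fun x b =>
    congrArg (fun y => tmk (M := M) (B := G.coeff) y b) (h x)
  map_map {_ _ K} _ _ {_ _ L} _ _ _ h := tensorOver_ext fun x b =>
    congrArg (fun y => tmk (M := L) (B := K.coeff) y b) (h x).symm
  barSection := tensorBarSection
  barSection_natural n G H f := barTensor_ext fun x a => by
    change (tensorBarSection n H).hom (tmk (M := Rep.of (H.barRep n)) (B := H.coeff)
        ((barMap f n).hom (Finsupp.single x 1)) a) =
      (tensorOverMap (sdMap (freeMap f)) (barMap (freeMap f) n) (coeffToRes (freeMap f))).hom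
        ((tensorBarSection n G).hom (tmk (M := Rep.of (G.barRep n)) (B := G.coeff)
          (Finsupp.single x 1) a))
    rw [barMap_single, tensorBarSection_single, tensorBarSection_single, tensorOverMap_tmk]
    refine congrArg₂ (fun y b => tmk (M := Rep.of (H.freeObj.barRep n)) (B := H.freeObj.coeff) y b)
      ?_ ?_
    · exact (congrArg (Finsupp.single · 1) (freeMap_freeTuple f x).symm).trans
        (barMap_single (freeMap f) n (freeTuple x)).symm
    · change H.ρ (f.hom (x 0))⁻¹ a = G.ρ (x 0)⁻¹ a
      rw [← map_inv, f.map_ρ]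
  barSection_counit n G := barTensor_ext fun x a => by
    change (tensorOverMap (sdMap ((freeCotriple α).ε.app G)) (barMap ((freeCotriple α).ε.app G) n)
      (coeffToRes ((freeCotriple α).ε.app G))).hom
        ((tensorBarSection n G).hom (tmk (M := Rep.of (G.barRep n)) (B := G.coeff)
          (Finsupp.single x 1) a)) =
      tmk (M := Rep.of (G.barRep n)) (B := G.coeff) (Finsupp.single x 1) a
    refine (congrArg (tensorOverMap (sdMap ((freeCotriple α).ε.app G))
      (barMap ((freeCotriple α).ε.app G) n) (coeffToRes ((freeCotriple α).ε.app G))).hom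
      (tensorBarSection_single n x a)).trans ?_
    -- Under the counit the section becomes `x_0⁻¹ x ⊗ x_0⁻¹ a`, a diagonal translate of `x ⊗ a`.
    refine Eq.trans (congrArg₂ (fun y b => tmk (M := Rep.of (G.barRep n)) (B := G.coeff) y b)
      ?_ ?_) (tmk_smul_smul (M := Rep.of (G.barRep n)) (B := G.coeff)
        (SemidirectProduct.inl (x 0)⁻¹) (Finsupp.single x 1) a)
    · exact (barMap_single ((freeCotriple α).ε.app G) n (freeTuple x)).trans
        ((congrArg (Finsupp.single · 1) (counit_freeTuple x)).trans (barRep_single n _ x 1).symm)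
    · exact (coeffRep_inl _ _).symm

end TensorCoefficients

section HomCoefficients

variable {α : Representation ℤ Γ A} {G H K : GammaGroup α}

/-- The restriction of equivariant maps to `A` along a map `g` which is equivariant along `f`. -/
def homRestrict (f : G ⟶ H) {M : Rep.{u} ℤ G.sd} {N : Rep.{u} ℤ H.sd}
    (g : M ⟶ Rep.res (sdMap f) N) : (N ⟶ H.coeff) →ₗ[ℤ] (M ⟶ G.coeff) where
  toFun h := g ≫ Rep.resMap (sdMap f) h ≫ resToCoeff f
  map_add' _ _ := rfl
  map_smul' _ _ := rfl

lemma homRestrict_apply (f : G ⟶ H) {M : Rep.{u} ℤ G.sd} {N : Rep.{u} ℤ H.sd}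
    (g : M ⟶ Rep.res (sdMap f) N) (h : N ⟶ H.coeff) (x : M.V) :
    (homRestrict f g h).hom x = h.hom (g.hom x) := rfl

lemma barHom_ext {n : ℕ} {N : Rep.{u} ℤ G.sd} {p q : Rep.of (G.barRep n) ⟶ N}
    (h : ∀ x : Fin (n + 1) → G.carrier,
      p.hom (Finsupp.single x 1) = q.hom (Finsupp.single x 1)) : p = q := by
  let _ := N.hV2
  have : p.hom.toLinearMap = q.hom.toLinearMap :=
    Finsupp.lhom_ext' fun x => LinearMap.ext_ring (h x)
  exact rep_hom_ext (LinearMap.congr_fun this)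

/-- The equivariant map `x ↦ x_0 h(|x_0⁻¹ x_i|)` for an equivariant map `h` from the bar module of
`F(G)`. -/
def homBarSectionFun (n : ℕ) (G : GammaGroup α) (h : Rep.of (G.freeObj.barRep n) ⟶ G.freeObj.coeff) :
    Rep.of (G.barRep n) ⟶ G.coeff :=
  Rep.ofHom ⟨Finsupp.linearCombination ℤ fun x : Fin (n + 1) → G.carrier =>
      G.ρ (x 0) (h.hom (Finsupp.single (freeTuple x) 1) : A), fun s => by
    refine Finsupp.lhom_ext' fun x => LinearMap.ext_ring ?_
    change Finsupp.linearCombination ℤ _ (G.barRep n s (Finsupp.single x 1)) =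
      G.coeffRep s (Finsupp.linearCombination ℤ _ (Finsupp.single x 1))
    rw [barRep_single, Finsupp.linearCombination_single, Finsupp.linearCombination_single, one_smul,
      one_smul, ← ρ_leftAct, freeTuple_leftAct]
    refine congrArg (G.ρ (G.leftAct s (x 0))) ?_
    refine Eq.trans ?_ (coeffRep_inr (G := G.freeObj) s.right _)
    exact (congrArg h.hom (barRep_single n _ _ _).symm).trans (Rep.hom_comm_apply h _ _)⟩

lemma homBarSectionFun_single (n : ℕ) (h : Rep.of (G.freeObj.barRep n) ⟶ G.freeObj.coeff)
    (x : Fin (n + 1) → G.carrier) : (homBarSectionFun n G h).hom (Finsupp.single x 1) =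
      G.ρ (x 0) (h.hom (Finsupp.single (freeTuple x) 1)) :=
  (Finsupp.linearCombination_single ℤ _ _).trans (one_smul _ _)

/-- `homBarSectionFun` as a linear map. -/
def homBarSection (n : ℕ) (G : GammaGroup α) :
    (Rep.of (G.freeObj.barRep n) ⟶ G.freeObj.coeff) →ₗ[ℤ] (Rep.of (G.barRep n) ⟶ G.coeff) where
  toFun := homBarSectionFun n G
  map_add' h k := barHom_ext fun x => by
    refine (homBarSectionFun_single n (h + k) x).trans ((map_add (G.ρ (x 0)) _ _).trans ?_)
    exact (congrArg₂ (· + ·) (homBarSectionFun_single n h x) (homBarSectionFun_single n k x)).symm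
  map_smul' m h := barHom_ext fun x => by
    refine (homBarSectionFun_single n (m • h) x).trans ((map_zsmul (G.ρ (x 0)) _ _).trans ?_)
    exact (congrArg (m • ·) (homBarSectionFun_single n h x)).symm

/-- The coefficient system `M ↦ Hom_{G ⋊ Γ}(M, A)`. -/
def homCoefficients (α : Representation ℤ Γ A) : CoefficientSystem α (ModuleCat.{u} ℤ)ᵒᵖ where
  F G := ((linearYoneda ℤ (Rep.{u} ℤ G.sd)).obj G.coeff).rightOp
  additive _ := inferInstance
  map f _ _ g := (ModuleCat.ofHom (homRestrict f g)).op
  comp_map _ _ _ _ _ _ := rfl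
  map_comp _ _ _ _ _ _ := rfl
  map_id {G M} g h := Quiver.Hom.unop_inj (ModuleCat.hom_ext (LinearMap.ext
    fun (k : M ⟶ G.coeff) => rep_hom_ext fun x => congrArg k.hom (h x)))
  map_map {_ _ K} _ _ {_ _ L} _ _ _ h := Quiver.Hom.unop_inj (ModuleCat.hom_ext (LinearMap.ext
    fun (k : L ⟶ K.coeff) => rep_hom_ext fun x => congrArg k.hom (h x).symm))
  barSection n G := (ModuleCat.ofHom (homBarSection n G)).op
  barSection_natural n G H f := Quiver.Hom.unop_inj (ModuleCat.hom_ext (LinearMap.ext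
    fun (k : Rep.of (H.freeObj.barRep n) ⟶ H.freeObj.coeff) => barHom_ext fun x => by
      change (homBarSectionFun n H k).hom ((barMap f n).hom (Finsupp.single x 1)) =
        (homBarSectionFun n G (homRestrict (freeMap f) (barMap (freeMap f) n) k)).hom
          (Finsupp.single x 1)
      rw [barMap_single, homBarSectionFun_single, homBarSectionFun_single, homRestrict_apply,
        barMap_single, freeMap_freeTuple]
      exact LinearMap.congr_fun (f.map_ρ (x 0)) _))
  barSection_counit n G := Quiver.Hom.unop_inj (ModuleCat.hom_ext (LinearMap.ext
    fun (k : Rep.of (G.barRep n) ⟶ G.coeff) => barHom_ext fun x => by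
      change (homBarSectionFun n G (homRestrict ((freeCotriple α).ε.app G)
        (barMap ((freeCotriple α).ε.app G) n) k)).hom (Finsupp.single x 1) =
          k.hom (Finsupp.single x 1)
      refine (homBarSectionFun_single n (homRestrict ((freeCotriple α).ε.app G)
        (barMap ((freeCotriple α).ε.app G) n) k) x).trans ?_
      have h1 : (barMap ((freeCotriple α).ε.app G) n).hom (Finsupp.single (freeTuple x) 1) =
          (Rep.of (G.barRep n)).ρ (SemidirectProduct.inl (x 0)⁻¹) (Finsupp.single x (1 : ℤ)) :=
        (barMap_single ((freeCotriple α).ε.app G) n (freeTuple x)).trans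
          ((congrArg (Finsupp.single · 1) (counit_freeTuple x)).trans (barRep_single n _ x 1).symm)
      have h2 := (congrArg k.hom h1).trans ((Rep.hom_comm_apply k _ _).trans (coeffRep_inl _ _))
      -- By equivariance of `k`, the value is `x_0 (x_0⁻¹ k(x))`.
      exact (congrArg (G.ρ (x 0)) h2).trans (Representation.self_inv_apply _ _ _)))

end HomCoefficients

end

end EquivariantHomology

/-! ### Right derived functors through the opposite category -/

namespace CotripleResolution

open Opposite

noncomputable section

section Unop

variable {V : Type*} [Category* V] [Limits.HasZeroMorphisms V] {ι : Type*} {c : ComplexShape ι}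

lemma homologyUnop_hom_naturality {K L : HomologicalComplex Vᵒᵖ c} (φ : K ⟶ L) (i : ι)
    [K.HasHomology i] [L.HasHomology i] :
    HomologicalComplex.homologyMap ((HomologicalComplex.unopFunctor V c).map φ.op) i ≫
        (K.homologyUnop i).hom =
      (L.homologyUnop i).hom ≫ (HomologicalComplex.homologyMap φ i).unop :=
  congrArg Quiver.Hom.unop (HomologicalComplex.homologyOp_hom_naturality
    ((HomologicalComplex.unopFunctor V c).map φ.op) i).symm

end Unop

/-- Pastes three naturality squares: unop of homology, comparison in the opposite category, and
identification of right with left derived functors. -/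
lemma comp_unop_comm {E : Type*} [Category* E] {c₁ c₂ r₁ r₂ : E} {h₁ h₂ l₁ l₂ : Eᵒᵖ}
    {u₁ : c₁ ⟶ unop h₁} {u₂ : c₂ ⟶ unop h₂} {c : c₂ ⟶ c₁} {k : h₁ ⟶ h₂} {b₁ : l₁ ⟶ h₁} {b₂ : l₂ ⟶ h₂}
    {l : l₁ ⟶ l₂} {j₁ : unop l₁ ⟶ r₁} {j₂ : unop l₂ ⟶ r₂} {r : r₂ ⟶ r₁}
    (hu : c ≫ u₁ = u₂ ≫ k.unop) (hb : l ≫ b₂ = b₁ ≫ k) (hj : j₂ ≫ r = l.unop ≫ j₁) :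
    (u₂ ≫ b₂.unop ≫ j₂) ≫ r = c ≫ u₁ ≫ b₁.unop ≫ j₁ := by
  have hb' : b₂.unop ≫ l.unop = k.unop ≫ b₁.unop := congrArg Quiver.Hom.unop hb
  rw [reassoc_of% hu, Category.assoc, Category.assoc, hj, reassoc_of% hb']

variable {C D : Type*} [Category* C] [Category* D] [Abelian D] (W : Comonad C)

/-- The left derived functors of isomorphic functors. -/
def leftDerivedCongr {T T' : C ⥤ D} (e : T ≅ T') (n : ℕ) : leftDerived W T n ≅ leftDerived W T' n :=
  Functor.isoWhiskerLeft (resolution W) (Functor.isoWhiskerRight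
    ((SimplicialObject.whiskering C D).mapIso e) (AlgebraicTopology.alternatingFaceMapComplex D ⋙
      HomologicalComplex.homologyFunctor D _ n))

/-- The cochain complex of the cosimplicial object `T (W_* X)`. -/
def cotripleCocomplex (T : Cᵒᵖ ⥤ D) : Cᵒᵖ ⥤ CochainComplex D ℕ :=
  (resolution W).op ⋙ (simplicialCosimplicialEquiv C).functor ⋙
    (CosimplicialObject.whiskering Cᵒᵖ D).obj T ⋙ AlgebraicTopology.alternatingCofaceMapComplex D

lemma unop_alternatingSum {X Y : Dᵒᵖ} {n : ℕ} (f : Fin n → (X ⟶ Y)) :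
    (∑ i : Fin n, (-1 : ℤ) ^ (i : ℕ) • f i).unop =
      ∑ i : Fin n, (-1 : ℤ) ^ (i : ℕ) • (f i).unop := by
  simp only [unop_sum, unop_zsmul]

/-- The cochain complex of `T (W_* X)` is the opposite of the chain complex of `T (W_* X)`. -/
def cotripleCocomplexIso (T : Cᵒᵖ ⥤ D) (X : C) : (cotripleCocomplex W T).obj (op X) ≅
    ((cotripleComplex W T.rightOp).obj X).unop :=
  -- The terms coincide; what remains is that `unop` respects the alternating sum of faces.
  HomologicalComplex.Hom.isoOfComponents (fun _ => Iso.refl _) fun i j hij => by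
    obtain rfl : i + 1 = j := hij
    refine (Category.id_comp _).trans (Eq.trans ?_ (Category.comp_id _).symm)
    refine Eq.trans ?_ (CochainComplex.of_d _ _ _).symm
    have h := AlgebraicTopology.AlternatingFaceMapComplex.obj_d_eq
      (((SimplicialObject.whiskering C Dᵒᵖ).obj T.rightOp).obj ((resolution W).obj X)) i
    refine (congrArg Quiver.Hom.unop h).trans ?_
    exact unop_alternatingSum _

/-- The right derived functors of a contravariant functor with values in `D`, as left derived functors
with values in `Dᵒᵖ`. -/
def rightDerivedIso (T : Cᵒᵖ ⥤ D) (n : ℕ) :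
    rightDerived W T n ≅ (leftDerived W T.rightOp n).leftOp :=
  NatIso.ofComponents (fun X =>
    (HomologicalComplex.homologyFunctor D _ n).mapIso (cotripleCocomplexIso W T X.unop) ≪≫
      HomologicalComplex.homologyUnop ((cotripleComplex W T.rightOp).obj X.unop) n) fun {X Y} f => by
    have h1 : (cotripleCocomplex W T).map f ≫ (cotripleCocomplexIso W T Y.unop).hom =
        (cotripleCocomplexIso W T X.unop).hom ≫ (HomologicalComplex.unopFunctor D _).map
          ((cotripleComplex W T.rightOp).map f.unop).op := by
      ext i
      exact (Category.comp_id _).trans (Category.id_comp _).symm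
    have h2 := homologyUnop_hom_naturality ((cotripleComplex W T.rightOp).map f.unop) n
    have h3 := (HomologicalComplex.homologyMap_comp _ _ n).symm.trans
      ((congrArg (HomologicalComplex.homologyMap · n) h1).trans
        (HomologicalComplex.homologyMap_comp _ _ n))
    refine (Category.assoc _ _ _).symm.trans ?_
    refine (congrArg (· ≫ (HomologicalComplex.homologyUnop _ n).hom) h3).trans ?_
    refine (Category.assoc _ _ _).trans ?_
    exact (congrArg _ h2).trans (Category.assoc _ _ _).symm

end

end CotripleResolution

/-! ### Derivations as maps out of the augmentation ideal, and the conclusion -/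

namespace EquivariantHomology

open CotripleResolution

noncomputable section

variable {Γ : Type u} [Group Γ] {A : Type u} [AddCommGroup A] {α : Representation ℤ Γ A}

namespace GammaGroup

variable {G H : GammaGroup α}

/-- The element `x - 1` of the augmentation ideal. -/
def subOne (x : G.carrier) : G.augIdeal :=
  ⟨Finsupp.single x 1 - Finsupp.single 1 1, by simp [augIdeal, augmentation]⟩

/-- Together with `subOne_act`, this makes `x ↦ x - 1` a `Γ`-derivation into `I(G)`; it is the
universal one. -/
lemma subOne_mul (x y : G.carrier) :
    subOne (x * y) = (HAdd.hAdd : G.augIdealRep.V → G.augIdealRep.V → G.augIdealRep.V) (subOne x)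
      (G.augIdealRep.ρ (SemidirectProduct.inl x) (subOne y)) := by
  apply Subtype.ext
  change _ = (Finsupp.single x 1 - Finsupp.single 1 1) + G.groupRing (SemidirectProduct.inl x)
    (Finsupp.single y 1 - Finsupp.single 1 1)
  simp [subOne, groupRing, leftAct, map_sub]

lemma subOne_act (σ : Γ) (x : G.carrier) :
    subOne (G.act σ x) = G.augIdealRep.ρ (SemidirectProduct.inr σ) (subOne x) := by
  apply Subtype.ext
  change _ = G.groupRing (SemidirectProduct.inr σ) (Finsupp.single x 1 - Finsupp.single 1 1)
  simp [subOne, groupRing, leftAct, map_sub]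

/-- Replacing each `g` by `g - 1` subtracts the augmentation times `1`, which is zero here. So the
elements `g - 1` span `I(G)`, and maps out of it are tested on them. -/
lemma linearCombination_subOne (x : G.augIdeal) : Finsupp.linearCombination ℤ subOne x.1 = x := by
  have h : G.augIdeal.subtype ∘ₗ Finsupp.linearCombination ℤ subOne =
      LinearMap.id - (Finsupp.lsingle 1) ∘ₗ G.augmentation := by
    refine Finsupp.lhom_ext' fun x => LinearMap.ext_ring ?_
    simp [subOne, augmentation]
  have hx : G.augmentation x.1 = 0 := x.2
  refine Subtype.ext ((LinearMap.congr_fun h x.1).trans ?_)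
  simp [hx]

lemma augIdealMap_subOne (f : G ⟶ H) (x : G.carrier) :
    (augIdealMap f).hom (subOne x) = subOne (f.hom x) := by
  apply Subtype.ext
  change Finsupp.lmapDomain ℤ ℤ f.hom (Finsupp.single x 1 - Finsupp.single 1 1) = _
  simp [subOne, map_sub]

/-- As for `foxLin`, the linear extension of a derivation fails to be equivariant by an augmentation
term, which disappears on `I(G)`. -/
lemma linearCombination_groupRing (d : G.der) (s : G.sd) (y : G.carrier →₀ ℤ) :
    Finsupp.linearCombination ℤ d.1 (G.groupRing s y) =
      G.coeffRep s (Finsupp.linearCombination ℤ d.1 y) + G.augmentation y • d.1 s.left := by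
  have h : Finsupp.linearCombination ℤ d.1 ∘ₗ G.groupRing s =
      G.coeffRep s ∘ₗ Finsupp.linearCombination ℤ d.1 +
        LinearMap.toSpanSingleton ℤ A (d.1 s.left) ∘ₗ G.augmentation := by
    refine Finsupp.lhom_ext' fun x => LinearMap.ext_ring ?_
    have h1 := d.2.1 s.left (G.act s.right x)
    rw [d.2.2] at h1
    simp [groupRing, augmentation, leftAct, h1, coeffRep_apply, add_comm]
  exact LinearMap.congr_fun h y

/-- The equivariant map `I(G) → A`, `x - 1 ↦ d x` of a derivation `d`. -/
def derToHom (d : G.der) : G.augIdealRep ⟶ G.coeff :=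
  Rep.ofHom ⟨Finsupp.linearCombination ℤ d.1 ∘ₗ G.augIdeal.subtype, fun s => LinearMap.ext fun x => by
    have hx : G.augmentation x.1 = 0 := x.2
    refine (linearCombination_groupRing d s x.1).trans ?_
    rw [hx, zero_smul, add_zero]
    rfl⟩

lemma derToHom_subOne (d : G.der) (x : G.carrier) : (derToHom d).hom (subOne x) = d.1 x := by
  have h1 : d.1 1 = 0 := by
    have := d.2.1 1 1
    simpa using this
  change Finsupp.linearCombination ℤ d.1 (Finsupp.single x 1 - Finsupp.single 1 1) = d.1 x
  simp [map_sub, h1]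

lemma augIdeal_hom_ext {p q : G.augIdealRep ⟶ G.coeff}
    (h : ∀ x : G.carrier, p.hom (subOne x) = q.hom (subOne x)) : p = q := by
  have : p.hom.toLinearMap ∘ₗ Finsupp.linearCombination ℤ subOne =
      q.hom.toLinearMap ∘ₗ Finsupp.linearCombination ℤ subOne := by
    refine Finsupp.lhom_ext' fun x => LinearMap.ext_ring ?_
    have e : Finsupp.linearCombination ℤ (subOne (G := G)) (Finsupp.single x 1) = subOne x := by simp
    exact (congrArg p.hom e).trans ((h x).trans (congrArg q.hom e).symm)
  refine rep_hom_ext fun (y : G.augIdeal) => ?_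
  have e := linearCombination_subOne y
  exact (congrArg p.hom e).symm.trans ((LinearMap.congr_fun this y.1).trans (congrArg q.hom e))

/-- The derivation `x ↦ h (x - 1)` of an equivariant map `h : I(G) → A`. -/
def homToDer (h : G.augIdealRep ⟶ G.coeff) : G.der :=
  ⟨fun x => h.hom (subOne x), fun x y => by
    have h1 := Rep.hom_comm_apply h (SemidirectProduct.inl x) (subOne y)
    refine (congrArg h.hom (subOne_mul x y)).trans ((map_add h.hom (subOne x)
      (G.augIdealRep.ρ (SemidirectProduct.inl x) (subOne y))).trans ?_)
    exact congrArg (h.hom (subOne x) + ·) (h1.trans (coeffRep_inl _ _)),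
  fun σ x => (congrArg h.hom (subOne_act σ x)).trans
    ((Rep.hom_comm_apply h _ _).trans (coeffRep_inr _ _))⟩

/-- `Hom_{G ⋊ Γ}(I(G), A) = Der_Γ(G, A)`. -/
def homEquivDer (G : GammaGroup α) : (G.augIdealRep ⟶ G.coeff) ≃ₗ[ℤ] G.der where
  toFun := homToDer
  map_add' _ _ := rfl
  map_smul' _ _ := rfl
  invFun := derToHom
  left_inv h := augIdeal_hom_ext (derToHom_subOne (homToDer h))
  right_inv d := Subtype.ext (funext (derToHom_subOne d))

/-- The functors `Der_Γ(-, A)` and `Hom_{(-) ⋊ Γ}(I(-), A)` are isomorphic. -/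
def augFunctorIsoDer (α : Representation ℤ Γ A) :
    (homCoefficients α).augFunctor ≅ (derFunctor α).rightOp :=
  NatIso.ofComponents (fun G => (homEquivDer G).toModuleIso.symm.op) fun {G H} f => by
    refine Quiver.Hom.unop_inj (ModuleCat.hom_ext (LinearMap.ext fun (d : H.der) => ?_))
    change homRestrict f (augIdealMap f) (derToHom d) =
      derToHom ((derFunctor α).map f.op |>.hom d : G.der)
    refine augIdeal_hom_ext fun x => ?_
    refine ((homRestrict_apply f _ _ _).trans (congrArg (derToHom d).hom
      (augIdealMap_subOne f x))).trans ?_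
    exact (derToHom_subOne d _).trans (derToHom_subOne ((derFunctor α).map f.op |>.hom d : G.der) x).symm

end GammaGroup

open GammaGroup RelResolution

/-- The homology half of the comparison with cotriple derived functors. -/
theorem exists_homologyIso (α : Representation ℤ Γ A) (m : ℕ) :
    ∃ e : ∀ (G : GammaGroup α) (P : RelResolution G),
        P.homology (m + 2) ≅ (leftDerived (freeCotriple α) (augTensor α) (m + 1)).obj G,
      ∀ (G H : GammaGroup α) (f : G ⟶ H) (P : RelResolution G) (Q : RelResolution H)
        (φ : RelResolution.Hom f P Q),
        (e G P).hom ≫ (leftDerived (freeCotriple α) (augTensor α) (m + 1)).map f =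
          homologyMap φ (m + 2) ≫ (e H Q).hom :=
  -- The functor `augFunctor` of this system is `augTensor α`, and its complexes and chain maps are
  -- those of `homology` and `homologyMap`, by unfolding.
  (tensorCoefficients α).exists_leftDerivedIso m

/-- The cohomology half of the comparison with cotriple derived functors. -/
theorem exists_cohomologyIso (α : Representation ℤ Γ A) (m : ℕ) :
    ∃ e : ∀ (G : GammaGroup α) (P : RelResolution G),
        P.cohomology (m + 2) ≅
          (rightDerived (freeCotriple α) (derFunctor α) (m + 1)).obj (Opposite.op G),
      ∀ (G H : GammaGroup α) (f : G ⟶ H) (P : RelResolution G) (Q : RelResolution H)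
        (φ : RelResolution.Hom f P Q),
        (e H Q).hom ≫ (rightDerived (freeCotriple α) (derFunctor α) (m + 1)).map f.op =
          cohomologyMap φ (m + 2) ≫ (e G P).hom := by
  obtain ⟨e, he⟩ := (homCoefficients α).exists_leftDerivedIso m
  let i := leftDerivedCongr (freeCotriple α) (augFunctorIsoDer α) (m + 1)
  let j := rightDerivedIso (freeCotriple α) (derFunctor α) (m + 1)
  let a (G : GammaGroup α) (P : RelResolution G) := e G P ≪≫ i.app G
  have ha (G H : GammaGroup α) (f : G ⟶ H) (P : RelResolution G) (Q : RelResolution H)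
      (φ : RelResolution.Hom f P Q) :
      (leftDerived (freeCotriple α) (derFunctor α).rightOp (m + 1)).map f ≫ (a H Q).inv =
        (a G P).inv ≫ HomologicalComplex.homologyMap ((homCoefficients α).chainMap φ) (m + 2) := by
    rw [Iso.comp_inv_eq, Category.assoc, Iso.eq_inv_comp]
    refine (Category.assoc _ _ _).trans ((congrArg _ (i.hom.naturality f).symm).trans ?_)
    refine (Category.assoc _ _ _).symm.trans ?_
    exact (congrArg (· ≫ i.hom.app H) (he G H f P Q φ)).trans (Category.assoc _ _ _)
  -- The cochain complex `Hom(P_*, A)` is the unop of the complex with coefficients in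
  -- `homCoefficients α`, so its cohomology is the unop of the homology in the opposite category.
  refine ⟨fun G P => HomologicalComplex.homologyUnop ((homCoefficients α).complex P) (m + 2) ≪≫
    (a G P).symm.unop ≪≫ (j.app (Opposite.op G)).symm, fun G H f P Q φ => ?_⟩
  exact comp_unop_comm (homologyUnop_hom_naturality ((homCoefficients α).chainMap φ) (m + 2))
    (ha G H f P Q φ) (j.inv.naturality f.op).symm

end

end EquivariantHomology

theorem theorem3 {Γ : Type u} [Group Γ] {A : Type u} [AddCommGroup A]
    (α : Representation ℤ Γ A) (n : ℕ) (hn : 2 ≤ n) :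
    (∃ e : ∀ (G : GammaGroup α) (P : GammaGroup.RelResolution G),
        P.homology n ≅ (leftDerived (GammaGroup.freeCotriple α) (GammaGroup.augTensor α) (n - 1)).obj G,
      ∀ (G H : GammaGroup α) (f : G ⟶ H) (P : GammaGroup.RelResolution G) (Q : GammaGroup.RelResolution H)
        (φ : GammaGroup.RelResolution.Hom f P Q),
        (e G P).hom ≫ (leftDerived (GammaGroup.freeCotriple α) (GammaGroup.augTensor α) (n - 1)).map f =
          GammaGroup.RelResolution.homologyMap φ n ≫ (e H Q).hom) ∧
    (∃ e : ∀ (G : GammaGroup α) (P : GammaGroup.RelResolution G),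
        P.cohomology n ≅
          (rightDerived (GammaGroup.freeCotriple α) (GammaGroup.derFunctor α) (n - 1)).obj (Opposite.op G),
      ∀ (G H : GammaGroup α) (f : G ⟶ H) (P : GammaGroup.RelResolution G) (Q : GammaGroup.RelResolution H)
        (φ : GammaGroup.RelResolution.Hom f P Q),
        (e H Q).hom ≫ (rightDerived (GammaGroup.freeCotriple α) (GammaGroup.derFunctor α) (n - 1)).map f.op =
          GammaGroup.RelResolution.cohomologyMap φ n ≫ (e G P).hom) := by
  -- With `n = m + 2`, the truncated subtraction `n - 1` reduces to `m + 1`.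
  obtain ⟨m, rfl⟩ := Nat.exists_eq_add_of_le' hn
  exact ⟨exists_homologyIso α m, exists_cohomologyIso α m⟩
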